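/- Let $m\ge 1$ be an integer, let $\bar X>0$ and $M>\bar X$ be real, and put $\lambda=m/\bar X$, $\delta=M/\bar X=\lambda M/m$. Consider the storage process of the on-off policy with an infinite-size buffer, $$B(i+1)=B(i)-M\,\mathbf 1_{\{B(i)>M\}}+X(i),\qquad i=0,1,2,\dots,$$ where $B(0)\ge 0$ and $X(0),X(1),\dots$ are i.i.d., independent of $B(0)$, and Gamma distributed with pdf $f(x)=\frac{\lambda^m}{\Gamma(m)}x^{m-1}e^{-\lambda x}$, $x\ge 0$ (mean $\bar X$). A limiting pdf is a pdf $g$ on $[0,\infty)$ whose distribution is stationary for the process and is the limit in total variation of the law of $B(i)$ as $i\to\infty$, for every distribution of $B(0)$ on $[0,\infty)$. Notation: $\mathrm j=\sqrt{-1}$; $z^*$ is the complex conjugate and $\Re$ the real part; $W_0$ is the principal branch of the Lambert function (the inverse of $w\mapsto we^w$); $\gamma(a,z)=\int_0^z t^{a-1}e^{-t}\,dt$ for integers $a\ge 1$ and $z\in\mathbb C$. For $n,k\in\{0,\dots,m-1\}$ let $$\lambda_n=\lambda+\tfrac mM W_0\!\left(-\delta e^{-\delta}e^{-\mathrm j 2\pi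 n/m}\right),\qquad \eta_k=\tfrac{2\pi k}{m},\qquad \theta_k=\lambda(1-e^{\mathrm j\eta_k}),$$ $$a_{nk}=\big[2(\lambda_ne^{-\mathrm j\eta_k}+\theta_k^*)\big]^{-1},\qquad b_{nk}=\big[2(\lambda_ne^{\mathrm j\eta_k}+\theta_k)\big]^{-1},$$ $\zeta_0=M$, $\zeta_k=(1-e^{-\theta_kM})/\theta_k$ for $k\ne 0$, and $I_s(\beta)=\beta^{-m+s}\gamma(m-s,\beta M)$ for $s\in\{0,\dots,m-1\}$. (The $\lambda_n$ are those of the best-effort policy.) For $s,n\in\{0,\dots,m-1\}$ let $A_{s,n}=D_n+B_{sn}$, where $$\begin{aligned}D_n={}&\frac{\lambda_n\lambda}{m}\sum_{k=0}^{m-1}\Big(a_{nk}\zeta_k+b_{nk}\zeta_k^*-\frac{a_{nk}+b_{nk}}{\lambda_n}(1-e^{-\lambda_nM})\Big)-\lambda_n\sum_{t=0}^{m-1}(\lambda-\lambda_n)^t\Big[\frac{\lambda^{-t-1}}{t!}\gamma(t+1,\lambda M)\\&+\frac1m\sum_{k=0}^{m-1}\Re\Big\{(\lambda e^{\mathrm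 j\eta_k})^{-t}\Big(\zeta_k-\sum_{q=0}^{t}\frac{e^{\mathrm j\eta_kq}\lambda^{-1}}{q!}\gamma(q+1,\lambda M)\Big)\Big\}\Big]+1,\end{aligned}$$ $$\begin{aligned}B_{sn}={}&-\frac{\lambda_n(\lambda-\lambda_n)^s}{\lambda^{s+1}}+\frac{\lambda^m(-1)^{m-1-s}\lambda_n}{\lambda^{s+1}(m-1-s)!}\Big[I_s(\lambda_n-\lambda)\\&+\frac\lambda m\sum_{k=0}^{m-1}\Big(a_{nk}I_s(\theta_k-\lambda)+b_{nk}I_s(\theta_k^*-\lambda)-(a_{nk}+b_{nk})I_s(\lambda_n-\lambda)\Big)\\&-\sum_{t=0}^{m-1}\frac{(\lambda-\lambda_n)^t}{t!}\Big\{\frac{M^{m+t-s}}{m+t-s}+\frac1m\sum_{k=0}^{m-1}\Re\Big\{(\lambda e^{\mathrm j\eta_k})^{-t}\,t!\Big[I_s(-\lambda e^{\mathrm j\eta_k})-\sum_{q=0}^{t}\frac{(\lambda e^{\mathrm j\eta_k})^q}{q!}\frac{M^{m+q-s}}{m+q-s}\Big]\Big\}\Big\}\Big].\end{aligned}$$ Then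 the system of linear equations $\sum_{n=0}^{m-1}A_{s,n}c_n=1$, $s=0,\dots,m-1$, has a unique solution $(c_0,\dots,c_{m-1})\in\mathbb C^m$, and with this solution the stored energy has a (real-valued) limiting pdf $g$ given, for $0\le x<M$, by $$\begin{aligned}g(x)=\sum_{n=0}^{m-1}\lambda_nc_n\Big[&e^{-\lambda_nx}+\frac\lambda m\sum_{k=0}^{m-1}\Big(a_{nk}e^{-\theta_kx}+b_{nk}e^{-\theta_k^*x}-(a_{nk}+b_{nk})e^{-\lambda_nx}\Big)\\&-\sum_{t=0}^{m-1}\frac{(\lambda-\lambda_n)^t}{t!}e^{-\lambda x}\Big\{x^t+\frac1m\sum_{k=0}^{m-1}\Re\big\{(\lambda e^{\mathrm j\eta_k})^{-t}e^{\lambda xe^{\mathrm j\eta_k}}\gamma(t+1,\lambda xe^{\mathrm j\eta_k})\big\}\Big\}\Big],\end{aligned}$$ and, for $x\ge M$, by $$g(x)=\sum_{n=0}^{m-1}\lambda_nc_ne^{-\lambda_nx}.$$ -/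

import Mathlib

open MeasureTheory ProbabilityTheory Filter Topology Set
open scoped Matrix ComplexConjugate

universe u

noncomputable section

namespace OnOffBuffer

/-! ### The storage process and its limiting distribution -/

/-- `B` is the storage process of the on-off policy with an infinite buffer: `B 0` is an arbitrary
nonnegative initial energy, the harvested energies `X 0, X 1, …` are i.i.d. with law `ν` and
independent of `B 0`, and `B (i + 1) = B i - M * 1_{B i > M} + X i`. -/
structure IsStorageProcess {Ω : Type u} [MeasurableSpace Ω] (P : Measure Ω) (ν : Measure ℝ) (M : ℝ)
    (X B : ℕ → Ω → ℝ) : Prop where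
  measurable_harvest : ∀ i, Measurable (X i)
  law_harvest : ∀ i, P.map (X i) = ν
  indep_harvest : iIndepFun X P
  measurable_init : Measurable (B 0)
  init_nonneg : ∀ᵐ ω ∂P, 0 ≤ B 0 ω
  indep_init : IndepFun (B 0) (fun ω i => X i ω) P
  step : ∀ i ω, B (i + 1) ω = B i ω - (if M < B i ω then M else 0) + X i ω

/-- The law of the next buffer content when the present one has law `π` and an independent amount
of energy with law `ν` is harvested. -/
def nextLaw (ν : Measure ℝ) (M : ℝ) (π : Measure ℝ) : Measure ℝ :=
  (π.prod ν).map fun p => p.1 - (if M < p.1 then M else 0) + p.2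

/-- `π` is the limiting distribution of the storage process: a stationary probability distribution
on `[0, ∞)` to which the law of `B i` converges in total variation as `i → ∞`, whatever the
initial distribution. -/
structure IsLimitingDistribution (ν : Measure ℝ) (M : ℝ) (π : Measure ℝ) : Prop where
  isProbabilityMeasure : IsProbabilityMeasure π
  support : π (Iio 0) = 0
  stationary : nextLaw ν M π = π
  tendsto : ∀ (Ω : Type u) [MeasurableSpace Ω] (P : Measure Ω) [IsProbabilityMeasure P]
    (X B : ℕ → Ω → ℝ), IsStorageProcess P ν M X B →
      TendstoUniformlyOn (fun (i : ℕ) (A : Set ℝ) => (P.map (B i)).real A) (fun A => π.real A)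
        atTop {A | MeasurableSet A}

/-- `g` is a limiting pdf, on `[0, ∞)`, of the storage process. -/
structure IsLimitingPdf (ν : Measure ℝ) (M : ℝ) (g : ℝ → ℝ) : Prop where
  measurable : Measurable g
  nonneg : ∀ x, 0 ≤ x → 0 ≤ g x
  isLimitingDistribution : IsLimitingDistribution.{u} ν M
    ((volume.restrict (Ici 0)).withDensity fun x => ENNReal.ofReal (g x))

/-! ### Special functions -/

/-- The range of the principal branch of the Lambert W function: the region to the right of the
curve `-η cot η + η i`, `-π < η < π`, with the part `η ≥ 0` of the curve included. -/
def lambertRange : Set ℂ :=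
  {w | (w.im = 0 ∧ -1 ≤ w.re) ∨
    (0 < w.im ∧ w.im < Real.pi ∧ -(w.im * Real.cot w.im) ≤ w.re) ∨
    (-Real.pi < w.im ∧ w.im < 0 ∧ -(w.im * Real.cot w.im) < w.re)}

/-- The principal branch `W₀` of the Lambert W function: the inverse of `w ↦ w * exp w` on
`lambertRange`. -/
def lambertW0 (z : ℂ) : ℂ :=
  Function.invFunOn (fun w : ℂ => w * Complex.exp w) lambertRange z

/-- The lower incomplete Gamma function `γ(a, z) = ∫_0^z t ^ (a - 1) * exp (-t) dt`, for a positive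
integer `a` and a complex `z`, integrated along the segment `t = u * z`, `0 ≤ u ≤ 1`. -/
def lowerGamma (a : ℕ) (z : ℂ) : ℂ :=
  ∫ u in (0 : ℝ)..1, z * (((u : ℂ) * z) ^ (a - 1) * Complex.exp (-((u : ℂ) * z)))

/-! ### The parameters. Here `m` is the shape parameter, `Xbar` the mean harvested energy. -/

/-- `λ = m / Xbar` -/
def rate (m : ℕ) (Xbar : ℝ) : ℝ := m / Xbar

/-- `λ_n = λ + (m / M) * W₀ (-δ * exp (-δ) * exp (-2πni / m))` with `δ = M / Xbar` -/
def lam (m : ℕ) (Xbar M : ℝ) (n : ℕ) : ℂ :=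
  rate m Xbar + (m : ℂ) / M *
    lambertW0 (-((M / Xbar : ℝ) : ℂ) * Complex.exp (-((M / Xbar : ℝ) : ℂ)) *
      Complex.exp (-(2 * Real.pi * n / m * Complex.I)))

/-- `exp (i η_k)` with `η_k = 2πk / m` -/
def expEta (m k : ℕ) : ℂ := Complex.exp (2 * Real.pi * k / m * Complex.I)

/-- `θ_k = λ * (1 - exp (i η_k))` -/
def theta (m : ℕ) (Xbar : ℝ) (k : ℕ) : ℂ := rate m Xbar * (1 - expEta m k)

/-- `a_{nk} = [2 (λ_n exp (-i η_k) + θ_k^*)]⁻¹` -/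
def coeffA (m : ℕ) (Xbar M : ℝ) (n k : ℕ) : ℂ :=
  (2 * (lam m Xbar M n * (expEta m k)⁻¹ + conj (theta m Xbar k)))⁻¹

/-- `b_{nk} = [2 (λ_n exp (i η_k) + θ_k)]⁻¹` -/
def coeffB (m : ℕ) (Xbar M : ℝ) (n k : ℕ) : ℂ :=
  (2 * (lam m Xbar M n * expEta m k + theta m Xbar k))⁻¹

/-- `ζ_k = M` for `k = 0`, and `ζ_k = (1 - exp (-θ_k M)) / θ_k` for `k ≠ 0` -/
def zeta (m : ℕ) (Xbar M : ℝ) (k : ℕ) : ℂ :=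
  if k = 0 then (M : ℂ)
  else (1 - Complex.exp (-(theta m Xbar k * M))) / theta m Xbar k

/-- The bracket that multiplies `λ_n c_n` in the limiting pdf on `[0, M)`. -/
def lowBracket (m : ℕ) (Xbar M : ℝ) (n : ℕ) (x : ℝ) : ℂ :=
  let l : ℂ := rate m Xbar
  let ln : ℂ := lam m Xbar M n
  let a : ℕ → ℂ := coeffA m Xbar M n
  let b : ℕ → ℂ := coeffB m Xbar M n
  let th : ℕ → ℂ := theta m Xbar
  let e : ℕ → ℂ := expEta m
  Complex.exp (-(ln * x))
    + l / m * ∑ k ∈ Finset.range m,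
        (a k * Complex.exp (-(th k * x)) + b k * Complex.exp (-(conj (th k) * x))
          - (a k + b k) * Complex.exp (-(ln * x)))
    - ∑ t ∈ Finset.range m, (l - ln) ^ t / (t.factorial : ℂ) * Complex.exp (-(l * x)) *
        ((x : ℂ) ^ t + 1 / m * ∑ k ∈ Finset.range m,
          ((((l * e k) ^ t)⁻¹ * Complex.exp (l * x * e k) *
            lowerGamma (t + 1) (l * x * e k)).re : ℂ))

/-- The number `D_n`. -/
def coeffD (m : ℕ) (Xbar M : ℝ) (n : ℕ) : ℂ :=
  let l : ℂ := rate m Xbar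
  let ln : ℂ := lam m Xbar M n
  let a : ℕ → ℂ := coeffA m Xbar M n
  let b : ℕ → ℂ := coeffB m Xbar M n
  let z : ℕ → ℂ := zeta m Xbar M
  let e : ℕ → ℂ := expEta m
  ln * l / m * ∑ k ∈ Finset.range m,
      (a k * z k + b k * conj (z k) - (a k + b k) / ln * (1 - Complex.exp (-(ln * M))))
    - ln * ∑ t ∈ Finset.range m, (l - ln) ^ t *
        ((l ^ (t + 1))⁻¹ / (t.factorial : ℂ) * lowerGamma (t + 1) (l * M)
          + 1 / m * ∑ k ∈ Finset.range m,
            ((((l * e k) ^ t)⁻¹ * (z k - ∑ q ∈ Finset.range (t + 1),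
              e k ^ q * l⁻¹ / (q.factorial : ℂ) * lowerGamma (q + 1) (l * M))).re : ℂ))
    + 1

/-- `I(β) = β ^ (-m + s) * γ(m - s, β M)`, used for `s < m` only. -/
def integralI (m : ℕ) (M : ℝ) (s : ℕ) (β : ℂ) : ℂ :=
  (β ^ (m - s))⁻¹ * lowerGamma (m - s) (β * M)

/-- The number `B_{sn}`, used for `s < m` only. -/
def coeffBsn (m : ℕ) (Xbar M : ℝ) (s n : ℕ) : ℂ :=
  let l : ℂ := rate m Xbar
  let ln : ℂ := lam m Xbar M n
  let a : ℕ → ℂ := coeffA m Xbar M n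
  let b : ℕ → ℂ := coeffB m Xbar M n
  let th : ℕ → ℂ := theta m Xbar
  let e : ℕ → ℂ := expEta m
  let J : ℂ → ℂ := integralI m M s
  (-1) * (ln * (l - ln) ^ s / l ^ (s + 1))
    + l ^ m * (-1) ^ (m - 1 - s) * ln / (l ^ (s + 1) * ((m - 1 - s).factorial : ℂ)) *
      (J (ln - l)
        + l / m * ∑ k ∈ Finset.range m,
          (a k * J (th k - l) + b k * J (conj (th k) - l) - (a k + b k) * J (ln - l))
        - ∑ t ∈ Finset.range m, (l - ln) ^ t / (t.factorial : ℂ) *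
          ((M : ℂ) ^ (m + t - s) / ((m + t - s : ℕ) : ℂ)
            + 1 / m * ∑ k ∈ Finset.range m,
              ((((l * e k) ^ t)⁻¹ * (t.factorial : ℂ) * (J (-(l * e k))
                - ∑ q ∈ Finset.range (t + 1), (l * e k) ^ q / (q.factorial : ℂ) *
                  ((M : ℂ) ^ (m + q - s) / ((m + q - s : ℕ) : ℂ)))).re : ℂ)))

/-- The `m × m` matrix with entries `A_{s,n} = D_n + B_{sn}`. -/
def systemMatrix (m : ℕ) (Xbar M : ℝ) : Matrix (Fin m) (Fin m) ℂ :=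
  Matrix.of fun s n => coeffD m Xbar M n + coeffBsn m Xbar M s n

end OnOffBuffer

end

/-! The chain has transition density `stepDensity`, so everything reduces to finding an invariant
probability density and showing that it attracts every initial law.

Put y = (λ - λ_n) / λ. The Lambert equation says exactly that y^m = exp(-λ_n M), and |y| < 1.
Convolving exp(-μ u) on [0, x] with the Gamma kernel gives (λ/α)^m times exp(-μ x) minus exp(-λ x)
times a Taylor polynomial of degree m - 1, where α = λ - μ. The factor is 1 for μ = θ_k, since exp(j
η_k) is an m-th root of unity, and y^(-m) for μ = λ_n. The bracket in the formula below M collapses,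
by averaging over roots of unity (`bracket_eq`), to y^m times a weighted sum of exp(-θ_k x) -
exp(-λ_n x). With these weights the Taylor polynomials cancel, and each single n solves the integral
equation below M. Above M it leaves a combination of x^s exp(-λ x), s < m, with coefficients B_{sn}
(`integral_stepDensity_candidate`), while D_n is the total mass of the n-th component
(`integral_candidate`).

An invariant probability density therefore needs B c = 0 and D · c = 1. The system A c = 1 only says
that all entries of B c equal one constant, but a Markov step preserves mass and the leftover
functions are positive, so that constant is zero (`eq_zero_of_coeffBsn_const`).

The Gamma density is positive on the positive half-line, which makes nonzero nonnegative invariant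
densities positive. Hence an invariant function of integral zero vanishes (`eq_zero_of_invariant`).
Applied to real and imaginary parts, this and the independence of the exponentials make A
invertible; it also shows that the solution is real, and its positivity follows likewise.
Convergence in total variation is an L¹ contraction argument: the kernel is minorized on bounded
sets, and functions dominated by a multiple of the invariant density stay so under iteration
(`tendsto_integral_abs_iterate`). -/

noncomputable section

namespace OnOffBuffer

/-! ### Markov operators given by a transition density -/

section MarkovDensity

variable {S : Type*} [MeasurableSpace S] {μ : Measure S} {k : S → S → ℝ} {h h' : S → ℝ}

/-- `k x` is, for almost every `x`, a probability density with respect to `μ`. -/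
structure IsMarkovDensity (μ : Measure S) (k : S → S → ℝ) : Prop where
  measurable : Measurable (Function.uncurry k)
  nonneg : ∀ x y, 0 ≤ k x y
  integral_eq : ∀ᵐ x ∂μ, ∫ y, k x y ∂μ = 1

/-- The action on densities of the transition density `k`. -/
def transfer (μ : Measure S) (k : S → S → ℝ) (h : S → ℝ) (y : S) : ℝ := ∫ x, k x y * h x ∂μ

lemma transfer_congr (hh : h =ᵐ[μ] h') : transfer μ k h = transfer μ k h' := by
  funext y
  refine integral_congr_ae ?_
  filter_upwards [hh] with x hx
  rw [hx]

lemma transfer_const_mul (a : ℝ) : transfer μ k (fun x => a * h x) = fun y => a * transfer μ k h y := by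
  funext y
  simp only [transfer, ← integral_const_mul]
  congr 1
  funext x
  ring

namespace IsMarkovDensity

variable (hk : IsMarkovDensity μ k)
include hk

lemma abs_transfer_le (h : S → ℝ) (y : S) :
    |transfer μ k h y| ≤ transfer μ k (fun x => |h x|) y := by
  refine (abs_integral_le_integral_abs).trans (le_of_eq ?_)
  simp only [transfer, abs_mul, abs_of_nonneg (hk.nonneg _ _)]

lemma transfer_nonneg (hh : 0 ≤ᵐ[μ] h) (y : S) : 0 ≤ transfer μ k h y := by
  refine integral_nonneg_of_ae ?_
  filter_upwards [hh] with x hx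
  exact mul_nonneg (hk.nonneg _ _) hx

variable [SFinite μ]

lemma integrable_prod (hh : Integrable h μ) :
    Integrable (fun p : S × S => k p.1 p.2 * h p.1) (μ.prod μ) := by
  have hm : AEStronglyMeasurable (fun p : S × S => k p.1 p.2 * h p.1) (μ.prod μ) :=
    hk.measurable.aestronglyMeasurable.mul hh.aestronglyMeasurable.comp_fst
  refine (integrable_prod_iff hm).2 ⟨?_, ?_⟩
  · filter_upwards [hk.integral_eq] with x hx
    exact (Integrable.of_integral_ne_zero (by rw [hx]; exact one_ne_zero)).mul_const _
  · refine hh.norm.congr ?_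
    filter_upwards [hk.integral_eq] with x hx
    simp only [norm_mul, Real.norm_of_nonneg (hk.nonneg _ _), integral_mul_const, hx, one_mul]

lemma ae_integrable (hh : Integrable h μ) : ∀ᵐ y ∂μ, Integrable (fun x => k x y * h x) μ :=
  (hk.integrable_prod hh).prod_left_ae

lemma integrable_transfer (hh : Integrable h μ) : Integrable (transfer μ k h) μ :=
  (hk.integrable_prod hh).integral_prod_right

lemma integral_transfer (hh : Integrable h μ) : ∫ y, transfer μ k h y ∂μ = ∫ x, h x ∂μ := by
  have h1 := integral_prod _ (hk.integrable_prod hh)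
  have h2 := integral_prod_symm _ (hk.integrable_prod hh)
  simp only [transfer]
  rw [← h2, h1]
  refine integral_congr_ae ?_
  filter_upwards [hk.integral_eq] with x hx
  simp only [integral_mul_const, hx, one_mul]

lemma transfer_add (hh : Integrable h μ) (hh' : Integrable h' μ) :
    transfer μ k (fun x => h x + h' x) =ᵐ[μ] fun y => transfer μ k h y + transfer μ k h' y := by
  filter_upwards [hk.ae_integrable hh, hk.ae_integrable hh'] with y h1 h2
  simp only [transfer]
  rw [← integral_add h1 h2]
  simp only [mul_add]

lemma transfer_sub (hh : Integrable h μ) (hh' : Integrable h' μ) :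
    transfer μ k (fun x => h x - h' x) =ᵐ[μ] fun y => transfer μ k h y - transfer μ k h' y := by
  filter_upwards [hk.ae_integrable hh, hk.ae_integrable hh'] with y h1 h2
  simp only [transfer]
  rw [← integral_sub h1 h2]
  simp only [mul_sub]

lemma transfer_mono (hh : Integrable h μ) (hh' : Integrable h' μ) (hle : h ≤ᵐ[μ] h') :
    transfer μ k h ≤ᵐ[μ] transfer μ k h' := by
  filter_upwards [hk.ae_integrable hh, hk.ae_integrable hh'] with y h1 h2
  refine integral_mono_ae h1 h2 ?_
  filter_upwards [hle] with x hx
  exact mul_le_mul_of_nonneg_left hx (hk.nonneg _ _)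

lemma integral_abs_transfer_le (hh : Integrable h μ) :
    ∫ y, |transfer μ k h y| ∂μ ≤ ∫ x, |h x| ∂μ := by
  rw [← hk.integral_transfer hh.abs]
  exact integral_mono (hk.integrable_transfer hh).abs (hk.integrable_transfer hh.abs)
    (hk.abs_transfer_le h)

/-- The absolute value of an invariant function is invariant. -/
lemma transfer_abs_of_invariant (hh : Integrable h μ) (hinv : transfer μ k h =ᵐ[μ] h) :
    transfer μ k (fun x => |h x|) =ᵐ[μ] fun x => |h x| := by
  -- One step applied to |h| dominates |h|, and both have the same integral, so they agree almost
  -- everywhere.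
  have hle : (fun x => |h x|) ≤ᵐ[μ] transfer μ k (fun x => |h x|) := by
    filter_upwards [hinv] with y hy
    rw [← hy]
    exact hk.abs_transfer_le h y
  exact (((integral_eq_iff_of_ae_le hh.abs (hk.integrable_transfer hh.abs) hle).1
    (hk.integral_transfer hh.abs).symm)).symm

lemma transfer_posPart_of_invariant (hh : Integrable h μ) (hinv : transfer μ k h =ᵐ[μ] h) :
    transfer μ k (fun x => (1 / 2) * (|h x| + h x)) =ᵐ[μ] fun x => (1 / 2) * (|h x| + h x) := by
  rw [transfer_const_mul]
  filter_upwards [hk.transfer_abs_of_invariant hh hinv, hinv, hk.transfer_add hh.abs hh]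
    with y h1 h2 h3
  rw [h3, h1, h2]

/-- If every nonnegative, nonzero invariant density is positive, then an invariant function with
positive integral is positive. -/
lemma pos_of_invariant
    (hpos : ∀ h : S → ℝ, Integrable h μ → (∀ x, 0 ≤ h x) → transfer μ k h =ᵐ[μ] h →
      0 < ∫ x, h x ∂μ → ∀ᵐ x ∂μ, 0 < h x)
    (hh : Integrable h μ) (hinv : transfer μ k h =ᵐ[μ] h) (hI : 0 < ∫ x, h x ∂μ) :
    ∀ᵐ x ∂μ, 0 < h x := by
  -- The positive part of `h` is invariant, and nonzero because `h` has positive integral; where it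
  -- is positive, so is `h`.
  have h1 := hpos (fun x => (1 / 2) * (|h x| + h x)) ((hh.abs.add hh).const_mul _)
    (fun x => by have := neg_abs_le (h x); linarith) (hk.transfer_posPart_of_invariant hh hinv) ?_
  · filter_upwards [h1] with x hx
    by_contra hneg
    rw [abs_of_nonpos (not_lt.1 hneg)] at hx
    linarith
  · refine hI.trans_le (integral_mono hh ((hh.abs.add hh).const_mul _) fun x => ?_)
    have := le_abs_self (h x)
    change h x ≤ 1 / 2 * (|h x| + h x)
    linarith

/-- If every nonnegative, nonzero invariant density is positive, then an invariant function with
vanishing integral vanishes. -/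
lemma eq_zero_of_invariant
    (hpos : ∀ h : S → ℝ, Integrable h μ → (∀ x, 0 ≤ h x) → transfer μ k h =ᵐ[μ] h →
      0 < ∫ x, h x ∂μ → ∀ᵐ x ∂μ, 0 < h x)
    (hh : Integrable h μ) (hinv : transfer μ k h =ᵐ[μ] h) (hI : ∫ x, h x ∂μ = 0) :
    h =ᵐ[μ] 0 := by
  have hnn : ∀ x, 0 ≤ (1 / 2) * (|h x| + h x) := fun x => by
    have := neg_abs_le (h x); linarith
  have hint := (hh.abs.add hh).const_mul (1 / 2)
  -- Either the positive part has no mass and `h ≤ 0`, or it is positive almost everywhere and `h ≥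
  -- 0`. A function of constant sign with integral zero vanishes.
  rcases (integral_nonneg hnn : 0 ≤ ∫ x, (1 / 2) * (|h x| + h x) ∂μ).eq_or_lt with h0 | h0
  · have h1 := (integral_eq_zero_iff_of_nonneg hnn hint).1 h0.symm
    have hle : h ≤ᵐ[μ] 0 := by
      filter_upwards [h1] with x hx
      have hx' : (1 / 2) * (|h x| + h x) = 0 := hx
      have := abs_nonneg (h x)
      change h x ≤ 0
      linarith
    exact (integral_eq_iff_of_ae_le hh (integrable_zero _ _ _) hle).1 (by simpa using hI)
  · have h1 := hpos _ hint hnn (hk.transfer_posPart_of_invariant hh hinv) h0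
    have hge : 0 ≤ᵐ[μ] h := by
      filter_upwards [h1] with x hx
      have hx' : 0 < (1 / 2) * (|h x| + h x) := hx
      by_contra hneg
      change ¬ (0 ≤ h x) at hneg
      rw [abs_of_neg (not_le.1 hneg)] at hx'
      linarith
    exact ((integral_eq_iff_of_ae_le (integrable_zero _ _ _) hh hge).1 (by simpa using hI.symm)).symm

lemma integrable_iterate (hh : Integrable h μ) (n : ℕ) : Integrable ((transfer μ k)^[n] h) μ := by
  induction n with
  | zero => exact hh
  | succ n ih => rw [Function.iterate_succ_apply']; exact hk.integrable_transfer ih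

omit [SFinite μ] in
lemma iterate_nonneg (h0 : ∀ x, 0 ≤ h x) (n : ℕ) (x : S) : 0 ≤ (transfer μ k)^[n] h x := by
  induction n generalizing x with
  | zero => exact h0 x
  | succ n ih =>
    rw [Function.iterate_succ_apply']
    exact hk.transfer_nonneg (ae_of_all _ ih) x

lemma integral_iterate (hh : Integrable h μ) (n : ℕ) :
    ∫ x, (transfer μ k)^[n] h x ∂μ = ∫ x, h x ∂μ := by
  induction n with
  | zero => rfl
  | succ n ih =>
    rw [Function.iterate_succ_apply', hk.integral_transfer (hk.integrable_iterate hh n), ih]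

lemma integral_abs_iterate_le (hh : Integrable h μ) (n : ℕ) :
    ∫ x, |(transfer μ k)^[n] h x| ∂μ ≤ ∫ x, |h x| ∂μ := by
  induction n with
  | zero => rfl
  | succ n ih =>
    rw [Function.iterate_succ_apply']
    exact (hk.integral_abs_transfer_le (hk.integrable_iterate hh n)).trans ih

lemma iterate_sub (hh : Integrable h μ) (hh' : Integrable h' μ) (n : ℕ) :
    (transfer μ k)^[n] (fun x => h x - h' x) =ᵐ[μ]
      fun y => (transfer μ k)^[n] h y - (transfer μ k)^[n] h' y := by
  induction n with
  | zero => exact Filter.EventuallyEq.rfl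
  | succ n ih =>
    simp only [Function.iterate_succ_apply']
    rw [transfer_congr ih]
    exact hk.transfer_sub (hk.integrable_iterate hh n) (hk.integrable_iterate hh' n)

omit [SFinite μ] hk in
lemma iterate_of_invariant {π : S → ℝ} (hinv : transfer μ k π =ᵐ[μ] π) (n : ℕ) :
    (transfer μ k)^[n] π =ᵐ[μ] π := by
  induction n with
  | zero => exact Filter.EventuallyEq.rfl
  | succ n ih =>
    simp only [Function.iterate_succ_apply']
    rw [transfer_congr ih]
    exact hinv

/-- One step contracts the `L¹` norm of a function with integral zero which has little mass outside
a set on which `k` is minorized. -/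
lemma integral_abs_transfer_le_of_minorized (hh : Integrable h μ) (h0 : ∫ x, h x ∂μ = 0)
    {s : Set S} (hs : MeasurableSet s) {φ : S → ℝ} (hφ : Integrable φ μ) (hφ0 : ∀ y, 0 ≤ φ y)
    (hkφ : ∀ x ∈ s, ∀ y, φ y ≤ k x y) {ε : ℝ} (hε : ∫ x in sᶜ, |h x| ∂μ ≤ ε) :
    ∫ y, |transfer μ k h y| ∂μ ≤
      ∫ x, |h x| ∂μ - (∫ y, φ y ∂μ) * (∫ x, |h x| ∂μ - 2 * ε) := by
  set p : S → ℝ := fun x => (1 / 2) * (|h x| + h x) with hp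
  set q : S → ℝ := fun x => (1 / 2) * (|h x| - h x) with hq
  have hpi : Integrable p μ := (hh.abs.add hh).const_mul _
  have hqi : Integrable q μ := (hh.abs.sub hh).const_mul _
  have hp0 : ∀ x, 0 ≤ p x := fun x => by have := neg_abs_le (h x); simp only [hp]; linarith
  have hq0 : ∀ x, 0 ≤ q x := fun x => by have := le_abs_self (h x); simp only [hq]; linarith
  have hple : ∀ x, p x ≤ |h x| := fun x => by have := le_abs_self (h x); simp only [hp]; linarith
  have hqle : ∀ x, q x ≤ |h x| := fun x => by have := neg_abs_le (h x); simp only [hq]; linarith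
  have hIp : ∫ x, p x ∂μ = (1 / 2) * ∫ x, |h x| ∂μ := by
    simp only [hp]; rw [integral_const_mul, integral_add hh.abs hh, h0, add_zero]
  have hIq : ∫ x, q x ∂μ = (1 / 2) * ∫ x, |h x| ∂μ := by
    simp only [hq]; rw [integral_const_mul, integral_sub hh.abs hh, h0, sub_zero]
  -- The positive and negative parts have half of the norm of `h` each, and all but ε of it lies in
  -- `s`, where the minorization applies.
  have key : ∀ r : S → ℝ, Integrable r μ → (∀ x, 0 ≤ r x) → (∀ x, r x ≤ |h x|) →
      (∫ x, r x ∂μ = (1 / 2) * ∫ x, |h x| ∂μ) →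
      ∀ᵐ y ∂μ, φ y * ((1 / 2) * ∫ x, |h x| ∂μ - ε) ≤ transfer μ k r y := by
    intro r hr hr0 hrle hIr
    have hrs : (1 / 2) * ∫ x, |h x| ∂μ - ε ≤ ∫ x in s, r x ∂μ := by
      have h1 := integral_add_compl hs hr
      have h2 : ∫ x in sᶜ, r x ∂μ ≤ ∫ x in sᶜ, |h x| ∂μ :=
        integral_mono hr.integrableOn hh.abs.integrableOn hrle
      linarith
    filter_upwards [hk.ae_integrable hr] with y hy
    calc φ y * ((1 / 2) * ∫ x, |h x| ∂μ - ε) ≤ φ y * ∫ x in s, r x ∂μ :=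
          mul_le_mul_of_nonneg_left hrs (hφ0 y)
      _ = ∫ x in s, φ y * r x ∂μ := (integral_const_mul _ _).symm
      _ ≤ ∫ x in s, k x y * r x ∂μ :=
          setIntegral_mono_on (hr.integrableOn.const_mul _) hy.integrableOn hs
            fun x hx => mul_le_mul_of_nonneg_right (hkφ x hx y) (hr0 x)
      _ ≤ transfer μ k r y :=
          setIntegral_le_integral hy (ae_of_all _ fun x => mul_nonneg (hk.nonneg _ _) (hr0 x))
  have hPh : transfer μ k h =ᵐ[μ] fun y => transfer μ k p y - transfer μ k q y := by
    have : h = fun x => p x - q x := by funext x; simp only [hp, hq]; ring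
    conv_lhs => rw [this]
    exact hk.transfer_sub hpi hqi
  -- |a - b| ≤ a + b - 2c as soon as c ≤ a and c ≤ b: the common lower bound of the two images
  -- cancels.
  have hle : (fun y => |transfer μ k h y|) ≤ᵐ[μ] fun y =>
      (transfer μ k p y + transfer μ k q y) - φ y * (∫ x, |h x| ∂μ - 2 * ε) := by
    filter_upwards [hPh, key p hpi hp0 hple hIp, key q hqi hq0 hqle hIq] with y h1 h2 h3
    simp only [h1, abs_le]
    constructor <;> linarith
  have hPp := hk.integrable_transfer hpi
  have hPq := hk.integrable_transfer hqi
  refine (integral_mono_ae (hk.integrable_transfer hh).abs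
    ((hPp.add hPq).sub (hφ.mul_const _)) hle).trans (le_of_eq ?_)
  have e1 : ∫ y, ((transfer μ k p + transfer μ k q) - fun y => φ y * (∫ x, |h x| ∂μ - 2 * ε)) y ∂μ
      = ∫ y, (transfer μ k p + transfer μ k q) y ∂μ - ∫ y, φ y * (∫ x, |h x| ∂μ - 2 * ε) ∂μ :=
    integral_sub (hPp.add hPq) (hφ.mul_const _)
  have e2 : ∫ y, (transfer μ k p + transfer μ k q) y ∂μ
      = ∫ y, transfer μ k p y ∂μ + ∫ y, transfer μ k q y ∂μ := integral_add hPp hPq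
  refine e1.trans ?_
  rw [e2, hk.integral_transfer hpi, hk.integral_transfer hqi, hIp, hIq, integral_mul_const]
  ring

end IsMarkovDensity
end MarkovDensity
namespace IsMarkovDensity

/-! ### Convergence to the invariant density -/

variable {S : Type*} [MeasurableSpace S] {μ : Measure S} {k : S → S → ℝ} {h π : S → ℝ} [SFinite μ]

lemma antitone_integral_abs_iterate (hk : IsMarkovDensity μ k) (hh : Integrable h μ) :
    Antitone fun n => ∫ x, |(transfer μ k)^[n] h x| ∂μ := by
  refine antitone_nat_of_succ_le fun n => ?_
  rw [Function.iterate_succ_apply']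
  exact hk.integral_abs_transfer_le (hk.integrable_iterate hh n)

lemma abs_iterate_le (hk : IsMarkovDensity μ k) (hπ : Integrable π μ)
    (hinv : transfer μ k π =ᵐ[μ] π) (hh : Integrable h μ) {K : ℝ}
    (hle : ∀ᵐ x ∂μ, |h x| ≤ K * π x) (n : ℕ) :
    ∀ᵐ x ∂μ, |(transfer μ k)^[n] h x| ≤ K * π x := by
  induction n with
  | zero => exact hle
  | succ n ih =>
    rw [Function.iterate_succ_apply']
    have hi := hk.integrable_iterate hh n
    filter_upwards [hk.transfer_mono hi.abs (hπ.const_mul K) ih, hinv] with y h1 h2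
    refine (hk.abs_transfer_le _ y).trans (h1.trans (le_of_eq ?_))
    simp only [transfer_const_mul, h2]

/-- Domination by `K * π` survives iteration, so one set `s` with little `π`-mass outside serves
every step: at most ε/4 of the norm lies off `s`. While the norm exceeds ε, each step then removes
at least the fixed amount c ε/2, which cannot go on forever. -/
lemma exists_integral_abs_iterate_le_of_bounded (hk : IsMarkovDensity μ k) (hπ : Integrable π μ)
    (hinv : transfer μ k π =ᵐ[μ] π)
    (hsmall : ∀ ε > 0, ∃ s : Set S, MeasurableSet s ∧ ∫ x in sᶜ, π x ∂μ ≤ ε ∧ ∃ φ : S → ℝ,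
      Integrable φ μ ∧ (∀ y, 0 ≤ φ y) ∧ 0 < ∫ y, φ y ∂μ ∧ ∀ x ∈ s, ∀ y, φ y ≤ k x y)
    (hh : Integrable h μ) (h0 : ∫ x, h x ∂μ = 0) {K : ℝ} (hK : 0 < K)
    (hle : ∀ᵐ x ∂μ, |h x| ≤ K * π x) {ε : ℝ} (hε : 0 < ε) :
    ∃ n, ∫ x, |(transfer μ k)^[n] h x| ∂μ ≤ ε := by
  obtain ⟨s, hs, hsπ, φ, hφ, hφ0, hφpos, hφk⟩ := hsmall (ε / (4 * K)) (by positivity)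
  by_contra! hcon
  set c := ∫ y, φ y ∂μ
  have hstep : ∀ n : ℕ, ∫ x, |(transfer μ k)^[n] h x| ∂μ ≤ ∫ x, |h x| ∂μ - n * (c * (ε / 2)) := by
    intro n
    induction n with
    | zero => simp
    | succ n ih =>
      have hi := hk.integrable_iterate hh n
      have hout : ∫ x in sᶜ, |(transfer μ k)^[n] h x| ∂μ ≤ ε / 4 := by
        calc ∫ x in sᶜ, |(transfer μ k)^[n] h x| ∂μ ≤ ∫ x in sᶜ, K * π x ∂μ :=
              integral_mono_ae hi.abs.integrableOn (hπ.const_mul K).integrableOn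
                (ae_restrict_of_ae (hk.abs_iterate_le hπ hinv hh hle n))
          _ = K * ∫ x in sᶜ, π x ∂μ := integral_const_mul _ _
          _ ≤ K * (ε / (4 * K)) := mul_le_mul_of_nonneg_left hsπ hK.le
          _ = ε / 4 := by field_simp
      have h1 := hk.integral_abs_transfer_le_of_minorized hi
        ((hk.integral_iterate hh n).trans h0) hs hφ hφ0 hφk hout
      rw [Function.iterate_succ_apply']
      have h2 : c * (ε / 2) ≤ c * (∫ x, |(transfer μ k)^[n] h x| ∂μ - 2 * (ε / 4)) := by
        refine mul_le_mul_of_nonneg_left ?_ hφpos.le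
        have := hcon n
        linarith
      push_cast
      linarith
  obtain ⟨n, hn⟩ := exists_nat_gt ((∫ x, |h x| ∂μ) / (c * (ε / 2)))
  have hcε : 0 < c * (ε / 2) := by positivity
  rw [div_lt_iff₀ hcε] at hn
  have := hstep n
  have := hcon n
  linarith

-- Truncate `h` between -nπ and nπ; since `π` is positive almost everywhere, dominated convergence
-- makes the error small. Subtracting `a * π` restores integral zero at the cost |a|, itself at most
-- the truncation error.
omit [SFinite μ] in
lemma exists_bounded_approx (hπ : Integrable π μ) (hπpos : ∀ᵐ x ∂μ, 0 < π x)
    (hπ1 : ∫ x, π x ∂μ = 1) (hh : Integrable h μ) (h0 : ∫ x, h x ∂μ = 0) {ε : ℝ} (hε : 0 < ε) :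
    ∃ h' : S → ℝ, Integrable h' μ ∧ ∫ x, h' x ∂μ = 0 ∧ (∃ K > 0, ∀ᵐ x ∂μ, |h' x| ≤ K * π x) ∧
      ∫ x, |h x - h' x| ∂μ ≤ ε := by
  set t : ℕ → S → ℝ := fun n x => max (-(n * π x)) (min (h x) (n * π x)) with ht
  have hti : ∀ n, Integrable (t n) μ := fun n =>
    ((hπ.const_mul (n : ℝ)).neg).sup (hh.inf (hπ.const_mul (n : ℝ)))
  have hlim : Tendsto (fun n => ∫ x, |h x - t n x| ∂μ) atTop (𝓝 (∫ _, (0 : ℝ) ∂μ)) := by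
    refine tendsto_integral_of_dominated_convergence (fun x => |h x|)
      (fun n => (hh.sub (hti n)).abs.aestronglyMeasurable) hh.abs (fun n => ?_) ?_
    · filter_upwards [hπpos] with x hx
      have hnx : 0 ≤ (n : ℝ) * π x := by positivity
      simp only [ht, Real.norm_eq_abs, abs_abs]
      rcases le_total (h x) (n * π x) with h1 | h1
      · rw [min_eq_left h1]
        rcases le_total (-(n * π x)) (h x) with h2 | h2
        · rw [max_eq_right h2]; simp
        · rw [max_eq_left h2, abs_of_nonpos (by linarith), abs_of_nonpos (by linarith)]; linarith
      · rw [min_eq_right h1, max_eq_right (by linarith), abs_of_nonneg (by linarith),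
          abs_of_nonneg (by linarith)]
        linarith
    · filter_upwards [hπpos] with x hx
      refine tendsto_const_nhds.congr' ?_
      obtain ⟨N, hN⟩ := exists_nat_gt (|h x| / π x)
      filter_upwards [eventually_ge_atTop N] with n hn
      have h1 : |h x| ≤ n * π x := by
        rw [div_lt_iff₀ hx] at hN
        have : (N : ℝ) * π x ≤ n * π x := by gcongr
        linarith
      simp only [ht]
      rw [min_eq_left (abs_le.1 h1).2, max_eq_right (abs_le.1 h1).1, sub_self, abs_zero]
  rw [integral_zero] at hlim
  obtain ⟨n, hn⟩ := (hlim.eventually (gt_mem_nhds (half_pos hε))).exists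
  set a := ∫ x, t n x ∂μ with ha
  have habs : |a| ≤ ∫ x, |h x - t n x| ∂μ := by
    have : a = -∫ x, (h x - t n x) ∂μ := by rw [integral_sub hh (hti n), h0]; ring
    rw [this, abs_neg]
    exact abs_integral_le_integral_abs
  refine ⟨fun x => t n x - a * π x, (hti n).sub (hπ.const_mul a), ?_,
    ⟨n + |a| + 1, by positivity, ?_⟩, ?_⟩
  · rw [integral_sub (hti n) (hπ.const_mul a), integral_const_mul, hπ1]; simp [ha]
  · filter_upwards [hπpos] with x hx
    have h1 : |t n x| ≤ n * π x := by
      have : 0 ≤ (n : ℝ) * π x := by positivity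
      simp only [ht, abs_le]
      exact ⟨le_max_left _ _, max_le (by linarith) (min_le_right _ _)⟩
    calc |t n x - a * π x| ≤ |t n x| + |a * π x| := abs_sub _ _
      _ ≤ n * π x + |a| * π x := by rw [abs_mul, abs_of_pos hx]; gcongr
      _ ≤ (n + |a| + 1) * π x := by nlinarith
  · have hdi : Integrable (fun x => |h x - t n x|) μ := (hh.sub (hti n)).abs
    calc ∫ x, |h x - (t n x - a * π x)| ∂μ ≤ ∫ x, (|h x - t n x| + |a| * π x) ∂μ := by
          refine integral_mono_ae (hh.sub ((hti n).sub (hπ.const_mul a))).abs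
            ((hh.sub (hti n)).abs.add (hπ.const_mul _)) ?_
          filter_upwards [hπpos] with x hx
          change |h x - (t n x - a * π x)| ≤ |h x - t n x| + |a| * π x
          have : h x - (t n x - a * π x) = (h x - t n x) + a * π x := by ring
          rw [this]
          refine (abs_add_le _ _).trans ?_
          rw [abs_mul, abs_of_pos hx]
      _ = ∫ x, |h x - t n x| ∂μ + |a| := by
          rw [integral_add hdi (hπ.const_mul _), integral_const_mul, hπ1, mul_one]
      _ ≤ ε := by linarith

/-- Convergence in `L¹` to a positive invariant density `π` when the transition density is
minorized on sets of almost full `π`-measure. -/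
theorem tendsto_integral_abs_iterate (hk : IsMarkovDensity μ k) (hπ : Integrable π μ)
    (hπpos : ∀ᵐ x ∂μ, 0 < π x) (hπ1 : ∫ x, π x ∂μ = 1) (hinv : transfer μ k π =ᵐ[μ] π)
    (hsmall : ∀ ε > 0, ∃ s : Set S, MeasurableSet s ∧ ∫ x in sᶜ, π x ∂μ ≤ ε ∧ ∃ φ : S → ℝ,
      Integrable φ μ ∧ (∀ y, 0 ≤ φ y) ∧ 0 < ∫ y, φ y ∂μ ∧ ∀ x ∈ s, ∀ y, φ y ≤ k x y)
    (hh : Integrable h μ) (h1 : ∫ x, h x ∂μ = 1) :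
    Tendsto (fun n => ∫ x, |(transfer μ k)^[n] h x - π x| ∂μ) atTop (𝓝 0) := by
  have hd : Integrable (fun x => h x - π x) μ := hh.sub hπ
  have hd0 : ∫ x, (h x - π x) ∂μ = 0 := by rw [integral_sub hh hπ, h1, hπ1, sub_self]
  have heq : ∀ n, ∫ x, |(transfer μ k)^[n] h x - π x| ∂μ =
      ∫ x, |(transfer μ k)^[n] (fun x => h x - π x) x| ∂μ := by
    intro n
    refine integral_congr_ae ?_
    filter_upwards [hk.iterate_sub hh hπ n, iterate_of_invariant hinv n] with x e1 e2
    rw [e1, e2]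
  simp only [heq]
  -- The norms do not increase, so a single small iterate is enough.
  have hanti := hk.antitone_integral_abs_iterate hd
  rw [Metric.tendsto_atTop]
  intro ε hε
  obtain ⟨h', hi', h0', ⟨K, hK, hle⟩, happ⟩ :=
    exists_bounded_approx hπ hπpos hπ1 hd hd0 (show 0 < ε / 4 by positivity)
  obtain ⟨N, hN⟩ := hk.exists_integral_abs_iterate_le_of_bounded hπ hinv hsmall hi' h0' hK hle
    (show 0 < ε / 4 by positivity)
  refine ⟨N, fun n hn => ?_⟩
  rw [Real.dist_eq, sub_zero, abs_of_nonneg (integral_nonneg fun x => abs_nonneg _)]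
  refine (hanti hn).trans_lt ?_
  have hdi : Integrable (fun x => (h x - π x) - h' x) μ := hd.sub hi'
  have h2 := hk.integral_abs_iterate_le hdi N
  have hiN := hk.integrable_iterate hd N
  have hiN' := hk.integrable_iterate hi' N
  have h3 : ∫ x, |(transfer μ k)^[N] (fun x => h x - π x) x| ∂μ ≤
      ∫ x, (|(transfer μ k)^[N] (fun x => (h x - π x) - h' x) x| +
        |(transfer μ k)^[N] h' x|) ∂μ := by
    refine integral_mono_ae hiN.abs ((hk.integrable_iterate hdi N).abs.add hiN'.abs) ?_
    filter_upwards [hk.iterate_sub hd hi' N] with x hx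
    rw [hx]
    have := abs_add_le ((transfer μ k)^[N] (fun x => h x - π x) x - (transfer μ k)^[N] h' x)
      ((transfer μ k)^[N] h' x)
    simpa using this
  rw [integral_add (hk.integrable_iterate hdi N).abs hiN'.abs] at h3
  simp only at h3 ⊢
  linarith

end IsMarkovDensity

/-! ### The transition density of the storage process -/

/-- The buffer content after the on-off policy has transmitted. -/
def afterTransmit (M x : ℝ) : ℝ := x - if M < x then M else 0

lemma measurable_afterTransmit (M : ℝ) : Measurable (afterTransmit M) :=
  measurable_id.sub (Measurable.ite measurableSet_Ioi measurable_const measurable_const)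

lemma afterTransmit_nonneg {M x : ℝ} (hx : 0 ≤ x) : 0 ≤ afterTransmit M x := by
  unfold afterTransmit; split_ifs <;> linarith

lemma afterTransmit_le {M x : ℝ} (hM : 0 ≤ M) : afterTransmit M x ≤ x := by
  unfold afterTransmit; split_ifs <;> linarith

lemma afterTransmit_of_lt {M x : ℝ} (h : M < x) : afterTransmit M x = x - M := by
  simp [afterTransmit, h]

lemma afterTransmit_of_le {M x : ℝ} (h : x ≤ M) : afterTransmit M x = x := by
  simp [afterTransmit, h.not_gt]

/-- The transition density of the storage process with Gamma distributed harvests. -/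
def stepDensity (a r M : ℝ) (x y : ℝ) : ℝ := gammaPDFReal a r (y - afterTransmit M x)

/-- Lebesgue measure on `[0, ∞)`. -/
abbrev volIci : Measure ℝ := volume.restrict (Ici 0)

section

variable {a r M : ℝ}

lemma measurable_uncurry_stepDensity : Measurable (Function.uncurry (stepDensity a r M)) :=
  (measurable_gammaPDFReal a r).comp
    (measurable_snd.sub ((measurable_afterTransmit M).comp measurable_fst))

lemma integral_gammaPDFReal (ha : 0 < a) (hr : 0 < r) : ∫ x, gammaPDFReal a r x = 1 := by
  rw [integral_eq_lintegral_of_nonneg_ae (ae_of_all _ (gammaPDFReal_nonneg ha hr))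
    (measurable_gammaPDFReal a r).aestronglyMeasurable]
  have := lintegral_gammaPDF_eq_one ha hr
  simp only [gammaPDF] at this
  rw [this, ENNReal.toReal_one]

lemma isMarkovDensity_stepDensity (ha : 0 < a) (hr : 0 < r) :
    IsMarkovDensity volIci (stepDensity a r M) where
  measurable := measurable_uncurry_stepDensity
  nonneg _ _ := gammaPDFReal_nonneg ha hr _
  integral_eq := by
    filter_upwards [ae_restrict_mem measurableSet_Ici] with x hx
    have h0 : ∀ y, y ∉ Ici (0 : ℝ) → stepDensity a r M x y = 0 := by
      intro y hy
      have := afterTransmit_nonneg (M := M) hx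
      simp only [mem_Ici, not_le] at hy
      simp only [stepDensity, gammaPDFReal]
      rw [if_neg (by linarith)]
    rw [setIntegral_eq_integral_of_forall_compl_eq_zero h0]
    simp only [stepDensity]
    rw [integral_sub_right_eq_self (gammaPDFReal a r), integral_gammaPDFReal ha hr]

lemma gammaMeasure_preimage_add (t : ℝ) {A : Set ℝ} (hA : MeasurableSet A) :
    gammaMeasure a r ((fun z => t + z) ⁻¹' A) = ∫⁻ y in A, gammaPDF a r (y - t) := by
  rw [gammaMeasure, withDensity_apply _ (measurable_const_add t hA),
    ← lintegral_indicator (measurable_const_add t hA), ← lintegral_indicator hA,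
    ← lintegral_add_left_eq_self (A.indicator fun y => gammaPDF a r (y - t)) t]
  congr 1
  funext z
  simp only [indicator, add_sub_cancel_left]
  rfl

lemma measurable_gammaPDF_sub :
    Measurable (fun p : ℝ × ℝ => gammaPDF a r (p.2 - afterTransmit M p.1)) :=
  measurable_uncurry_stepDensity.ennreal_ofReal

/-- After one step, the law of the buffer content has a density. -/
lemma nextLaw_eq_withDensity {π : Measure ℝ} [SFinite π] (hπ : π (Iio 0) = 0)
    (ha : 0 < a) (hr : 0 < r) :
    nextLaw (gammaMeasure a r) M π =
      volIci.withDensity fun y => ∫⁻ x, gammaPDF a r (y - afterTransmit M x) ∂π := by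
  have : IsProbabilityMeasure (gammaMeasure a r) := isProbabilityMeasure_gammaMeasure ha hr
  have hm : Measurable fun p : ℝ × ℝ => p.1 - (if M < p.1 then M else 0) + p.2 :=
    ((measurable_afterTransmit M).comp measurable_fst).add measurable_snd
  ext A hA
  rw [nextLaw, Measure.map_apply hm hA, Measure.prod_apply (hm hA), withDensity_apply _ hA,
    Measure.restrict_restrict hA]
  have h1 : ∀ x, gammaMeasure a r
      (Prod.mk x ⁻¹' ((fun p : ℝ × ℝ => p.1 - (if M < p.1 then M else 0) + p.2) ⁻¹' A)) =
      ∫⁻ y in A, gammaPDF a r (y - afterTransmit M x) :=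
    fun x => gammaMeasure_preimage_add (afterTransmit M x) hA
  simp only [h1]
  rw [lintegral_lintegral_swap measurable_gammaPDF_sub.aemeasurable,
    ← lintegral_inter_add_sdiff _ A measurableSet_Ici (B := Ici (0 : ℝ))]
  -- From a nonnegative level no negative level can be reached, so the density may be restricted to
  -- [0, ∞).
  have h2 : ∫⁻ y in A \ Ici 0, ∫⁻ x, gammaPDF a r (y - afterTransmit M x) ∂π = 0 := by
    rw [setLIntegral_congr_fun (hA.diff measurableSet_Ici) (g := fun _ => 0), lintegral_zero]
    intro y hy
    have hy0 : y < 0 := by simpa using hy.2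
    refine (lintegral_congr_ae ?_).trans lintegral_zero
    have : ∀ᵐ x ∂π, x ∉ Iio (0 : ℝ) := measure_eq_zero_iff_ae_notMem.1 hπ
    filter_upwards [this] with x hx
    have := afterTransmit_nonneg (M := M) (not_lt.1 hx)
    exact gammaPDF_of_neg (by linarith)
  rw [h2, add_zero]

lemma nextLaw_withDensity {h : ℝ → ℝ} (hm : AEMeasurable h volIci) (hh : Integrable h volIci)
    (h0 : 0 ≤ᵐ[volIci] h) (ha : 0 < a) (hr : 0 < r) :
    nextLaw (gammaMeasure a r) M (volIci.withDensity fun x => ENNReal.ofReal (h x)) =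
      volIci.withDensity fun y => ENNReal.ofReal (transfer volIci (stepDensity a r M) h y) := by
  have hsupp : (volIci.withDensity fun x => ENNReal.ofReal (h x)) (Iio 0) = 0 := by
    refine withDensity_absolutelyContinuous _ _ ?_
    rw [Measure.restrict_apply measurableSet_Iio]
    convert measure_empty (μ := (volume : Measure ℝ))
    ext x; simp
  have hk := isMarkovDensity_stepDensity (M := M) ha hr
  rw [nextLaw_eq_withDensity hsupp ha hr]
  refine withDensity_congr_ae ?_
  filter_upwards [hk.ae_integrable hh] with y hy
  have hsec : Measurable fun x => gammaPDF a r (y - afterTransmit M x) :=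
    measurable_gammaPDF_sub.comp (measurable_prodMk_right (y := y))
  rw [lintegral_withDensity_eq_lintegral_mul₀ hm.ennreal_ofReal hsec.aemeasurable, transfer,
    ofReal_integral_eq_lintegral_ofReal hy]
  · refine lintegral_congr fun x => ?_
    change ENNReal.ofReal (h x) * ENNReal.ofReal _ = _
    rw [mul_comm, ← ENNReal.ofReal_mul (gammaPDFReal_nonneg ha hr _)]
    rfl
  · filter_upwards [h0] with x hx
    exact mul_nonneg (hk.nonneg _ _) hx

/-! ### Irreducibility and minorization of the storage process -/

/-- A nonnegative, nonzero invariant density of the storage process is positive. -/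
lemma pos_of_stepDensity_invariant (ha : 0 < a) (hr : 0 < r) (hM : 0 < M) {h : ℝ → ℝ}
    (hh : Integrable h volIci) (h0 : ∀ x, 0 ≤ h x)
    (hinv : transfer volIci (stepDensity a r M) h =ᵐ[volIci] h) (hI : 0 < ∫ x, h x ∂volIci) :
    ∀ᵐ x ∂volIci, 0 < h x := by
  have hk := isMarkovDensity_stepDensity (M := M) ha hr
  -- The Gamma density is positive at every positive jump, so `y` receives mass as soon as `h`
  -- charges levels that lie below `y` after transmission.
  have hpos : ∀ s : Set ℝ, ∀ y, MeasurableSet s →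
      Integrable (fun x => stepDensity a r M x y * h x) volIci →
      0 < volIci (s ∩ {x | h x ≠ 0}) → (∀ x ∈ s, afterTransmit M x < y) →
      0 < transfer volIci (stepDensity a r M) h y := by
    intro s y hs hy hpos hlt
    rw [transfer, integral_pos_iff_support_of_nonneg
      (fun x => mul_nonneg (hk.nonneg _ _) (h0 x)) hy]
    refine hpos.trans_le (measure_mono fun x hx => ?_)
    have := hlt x hx.1
    exact mul_ne_zero (gammaPDFReal_pos ha hr (by linarith)).ne' hx.2
  -- Some [0, nM] carries mass, and every level above nM can be reached from it in one step.
  have hstart : ∃ n : ℕ, ∀ᵐ y ∂volIci, n * M < y → 0 < h y := by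
    have : ∃ n : ℕ, 0 < volIci (Iic (n * M) ∩ {x | h x ≠ 0}) := by
      by_contra! hcon
      have h1 : volIci (⋃ n : ℕ, Iic (n * M) ∩ {x | h x ≠ 0}) = 0 :=
        measure_iUnion_null fun n => le_antisymm (hcon n) zero_le
      have h2 : h =ᵐ[volIci] 0 := by
        filter_upwards [measure_eq_zero_iff_ae_notMem.1 h1] with x hx
        by_contra hne
        refine hx (mem_iUnion.2 ?_)
        obtain ⟨n, hn⟩ := exists_nat_gt (x / M)
        exact ⟨n, ((div_lt_iff₀ hM).1 hn).le, hne⟩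
      rw [integral_congr_ae h2] at hI
      simp at hI
    obtain ⟨n, hn⟩ := this
    refine ⟨n, ?_⟩
    filter_upwards [hk.ae_integrable hh, hinv] with y hy hyinv hlt
    rw [← hyinv]
    exact hpos _ y measurableSet_Iic hy hn fun x hx =>
      (afterTransmit_le hM.le).trans_lt (lt_of_le_of_lt hx hlt)
  obtain ⟨n, hn⟩ := hstart
  -- Positivity descends by M at a time: for y > nM, levels between (n + 1)M and y + M fall below y
  -- after transmission.
  have hdown : ∀ n : ℕ, (∀ᵐ y ∂volIci, n * M < y → 0 < h y) → ∀ᵐ y ∂volIci, 0 < y → 0 < h y := by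
    intro n
    induction n with
    | zero => intro h; simpa using h
    | succ n ih =>
      intro hn
      refine ih ?_
      filter_upwards [hk.ae_integrable hh, hinv] with y hy hyinv hlt
      rw [← hyinv]
      have hM1 : M ≤ (n + 1) * M := by nlinarith [(Nat.cast_nonneg n : (0 : ℝ) ≤ n)]
      refine hpos (Ioo ((n + 1) * M) (y + M)) y measurableSet_Ioo hy ?_ fun x hx => ?_
      · have h1 : volIci (Ioo ((n + 1) * M) (y + M) ∩ {x | h x ≠ 0}) =
            volIci (Ioo ((n + 1) * M) (y + M)) := by
          refine measure_congr ?_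
          filter_upwards [hn] with x hx
          refine propext ⟨fun h => h.1, fun h => ⟨h, ?_⟩⟩
          exact (hx (by push_cast; exact h.1)).ne'
        have h2 : volIci (Ioo ((n + 1) * M) (y + M)) = volume (Ioo ((n + 1) * M) (y + M)) := by
          rw [Measure.restrict_apply measurableSet_Ioo]
          congr 1
          refine inter_eq_left.2 fun x hx => ?_
          exact hM.le.trans (hM1.trans hx.1.le)
        rw [h1, h2, Real.volume_Ioo, ENNReal.ofReal_pos]
        linarith
      · rw [afterTransmit_of_lt (hM1.trans_lt hx.1)]
        linarith [hx.2]
  have hne : ∀ᵐ y ∂volIci, y ≠ 0 := ae_restrict_of_ae (by simp [ae_iff])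
  filter_upwards [hdown n hn, hne, ae_restrict_mem measurableSet_Ici] with y h1 h2 h3
  exact h1 (lt_of_le_of_ne h3 (Ne.symm h2))

/-- The transition density is minorized on bounded sets. -/
lemma stepDensity_minorized (ha : 1 ≤ a) (hr : 0 < r) (hM : 0 < M) {g : ℝ → ℝ}
    (hg : Integrable g volIci) {ε : ℝ} (hε : 0 < ε) :
    ∃ s : Set ℝ, MeasurableSet s ∧ ∫ x in sᶜ, g x ∂volIci ≤ ε ∧ ∃ φ : ℝ → ℝ,
      Integrable φ volIci ∧ (∀ y, 0 ≤ φ y) ∧ 0 < ∫ y, φ y ∂volIci ∧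
        ∀ x ∈ s, ∀ y, φ y ≤ stepDensity a r M x y := by
  have ha0 : 0 < a := by linarith
  have hlim : Tendsto (fun n : ℕ => ∫ x in (Icc (0 : ℝ) n)ᶜ, g x ∂volIci) atTop (𝓝 0) := by
    have := tendsto_setIntegral_of_antitone (μ := volIci) (f := g)
      (s := fun n : ℕ => (Icc (0 : ℝ) n)ᶜ) (fun n => measurableSet_Icc.compl)
      (fun m n hmn => compl_subset_compl.2 (Icc_subset_Icc_right (by exact_mod_cast hmn)))
      ⟨0, hg.integrableOn⟩
    convert this
    have h0 : volIci (⋂ n : ℕ, (Icc (0 : ℝ) n)ᶜ) = 0 := by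
      rw [Measure.restrict_apply (MeasurableSet.iInter fun n => measurableSet_Icc.compl)]
      convert measure_empty (μ := (volume : Measure ℝ))
      rw [eq_empty_iff_forall_notMem]
      rintro x ⟨hx, hx0⟩
      obtain ⟨n, hn⟩ := exists_nat_gt x
      exact mem_iInter.1 hx n ⟨hx0, hn.le⟩
    rw [Measure.restrict_eq_zero.2 h0, integral_zero_measure]
  obtain ⟨n, hn⟩ := (hlim.eventually (gt_mem_nhds hε)).exists
  -- From [0, n] into [n + 1, n + 2] the jump z satisfies 1 ≤ z ≤ n + 2. Then z^(a-1) ≥ 1, because a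
  -- ≥ 1, and the exponential is at least its value at n + 2.
  set c := r ^ a / Real.Gamma a * Real.exp (-(r * (n + 2))) with hc
  have hcpos : 0 < c := by
    have := Real.Gamma_pos_of_pos ha0
    positivity
  refine ⟨Icc 0 n, measurableSet_Icc, hn.le, (Icc ((n : ℝ) + 1) (n + 2)).indicator fun _ => c,
    ?_, fun y => indicator_nonneg (fun _ _ => hcpos.le) y, ?_, fun x hx y => ?_⟩
  · refine (integrable_indicator_iff measurableSet_Icc).2 (integrableOn_const ?_)
    exact (lt_of_le_of_lt (Measure.restrict_apply_le _ _) (by simp)).ne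
  · have h1 : volIci.real (Icc ((n : ℝ) + 1) (n + 2)) = 1 := by
      rw [measureReal_def, Measure.restrict_apply measurableSet_Icc, inter_eq_left.2]
      · rw [Real.volume_Icc, ENNReal.toReal_ofReal] <;> linarith
      · intro y hy
        have : (0 : ℝ) ≤ n := Nat.cast_nonneg n
        simp only [mem_Icc, mem_Ici] at *
        linarith
    rw [integral_indicator measurableSet_Icc, setIntegral_const, h1, one_smul]
    exact hcpos
  · by_cases hy : y ∈ Icc ((n : ℝ) + 1) (n + 2)
    swap
    · rw [indicator_of_notMem hy]
      exact gammaPDFReal_nonneg ha0 hr _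
    rw [indicator_of_mem hy]
    have h1 := afterTransmit_nonneg (M := M) hx.1
    have h2 := (afterTransmit_le (x := x) hM.le).trans hx.2
    simp only [mem_Icc] at hy
    have h3 : 1 ≤ y - afterTransmit M x := by linarith
    simp only [stepDensity, gammaPDFReal]
    rw [if_pos (by linarith), hc]
    have hG := Real.Gamma_pos_of_pos ha0
    have h4 : 1 ≤ (y - afterTransmit M x) ^ (a - 1) := Real.one_le_rpow h3 (by linarith)
    have h5 : Real.exp (-(r * (n + 2))) ≤ Real.exp (-(r * (y - afterTransmit M x))) := by
      refine Real.exp_le_exp.2 (neg_le_neg (mul_le_mul_of_nonneg_left ?_ hr.le))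
      linarith
    have h6 : 0 < r ^ a / Real.Gamma a := by positivity
    calc r ^ a / Real.Gamma a * Real.exp (-(r * (n + 2)))
        ≤ r ^ a / Real.Gamma a * Real.exp (-(r * (y - afterTransmit M x))) := by gcongr
      _ ≤ r ^ a / Real.Gamma a * (y - afterTransmit M x) ^ (a - 1) *
          Real.exp (-(r * (y - afterTransmit M x))) := by
        refine mul_le_mul_of_nonneg_right ?_ (Real.exp_pos _).le
        nlinarith

end

/-! ### The law of the storage process -/

/-- The joint law of the three variables is the triple product measure, and reassociating the
product regroups them. -/
lemma IndepFun.prodMk_left_of_prodMk_right {Ω α β γ : Type*} [MeasurableSpace Ω]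
    [MeasurableSpace α] [MeasurableSpace β] [MeasurableSpace γ] {P : Measure Ω}
    [IsProbabilityMeasure P] {U : Ω → α} {V : Ω → β} {W : Ω → γ} (hU : Measurable U)
    (hV : Measurable V) (hW : Measurable W) (h1 : IndepFun U (fun ω => (V ω, W ω)) P)
    (h2 : IndepFun V W P) : IndepFun (fun ω => (U ω, V ω)) W P := by
  have := Measure.isProbabilityMeasure_map (μ := P) hU.aemeasurable
  have := Measure.isProbabilityMeasure_map (μ := P) hV.aemeasurable
  have := Measure.isProbabilityMeasure_map (μ := P) hW.aemeasurable
  have hUV : IndepFun U V P := h1.comp measurable_id measurable_fst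
  rw [indepFun_iff_map_prod_eq_prod_map_map (hU.prodMk hV).aemeasurable hW.aemeasurable,
    (indepFun_iff_map_prod_eq_prod_map_map hU.aemeasurable hV.aemeasurable).1 hUV]
  have e1 := (indepFun_iff_map_prod_eq_prod_map_map hU.aemeasurable
    (hV.prodMk hW).aemeasurable).1 h1
  rw [(indepFun_iff_map_prod_eq_prod_map_map hV.aemeasurable hW.aemeasurable).1 h2] at e1
  refine (MeasurableEquiv.prodAssoc (α := α) (β := β) (γ := γ)).map_measurableEquiv_injective ?_
  have e2 : Measure.map MeasurableEquiv.prodAssoc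
      (((P.map U).prod (P.map V)).prod (P.map W)) =
      (P.map U).prod ((P.map V).prod (P.map W)) := Measure.prodAssoc_prod
  rw [e2, ← e1, Measure.map_map MeasurableEquiv.prodAssoc.measurable
    ((hU.prodMk hV).prodMk hW)]
  rfl

namespace IsStorageProcess

variable {Ω : Type u} [MeasurableSpace Ω] {P : Measure Ω} {ν : Measure ℝ} {M : ℝ}
  {X B : ℕ → Ω → ℝ}

/-- The hypotheses give independence only of the initial content and the harvests. Since the content
at time i depends on harvests before i alone, it is independent of `X i`. -/
lemma exists_measurable_eq (h : IsStorageProcess P ν M X B) (i : ℕ) :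
    ∃ Φ : ℝ × (Finset.range i → ℝ) → ℝ, Measurable Φ ∧
      ∀ ω, B i ω = Φ (B 0 ω, fun j => X j ω) := by
  induction i with
  | zero => exact ⟨Prod.fst, measurable_fst, fun ω => rfl⟩
  | succ i ih =>
    obtain ⟨Φ, hΦ, hΦB⟩ := ih
    have hres : Measurable fun p : ℝ × (Finset.range (i + 1) → ℝ) =>
        ((p.1, fun j : Finset.range i =>
          p.2 ⟨j, Finset.range_subset_range.2 i.le_succ j.2⟩) : ℝ × (Finset.range i → ℝ)) := by
      fun_prop
    refine ⟨fun p => afterTransmit M (Φ (p.1, fun j : Finset.range i =>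
        p.2 ⟨j, Finset.range_subset_range.2 i.le_succ j.2⟩)) +
        p.2 ⟨i, Finset.self_mem_range_succ i⟩, ?_, fun ω => ?_⟩
    · exact ((measurable_afterTransmit M).comp (hΦ.comp hres)).add (by fun_prop)
    · rw [h.step, hΦB]
      rfl

lemma measurable_buffer (h : IsStorageProcess P ν M X B) (i : ℕ) : Measurable (B i) := by
  obtain ⟨Φ, hΦ, hB⟩ := h.exists_measurable_eq i
  have : B i = Φ ∘ fun ω => (B 0 ω, fun j : Finset.range i => X j ω) := funext hB
  rw [this]
  exact hΦ.comp (h.measurable_init.prodMk (measurable_pi_lambda _ fun j => h.measurable_harvest j))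

lemma indepFun_harvest [IsProbabilityMeasure P] (h : IsStorageProcess P ν M X B) (i : ℕ) :
    IndepFun (B i) (X i) P := by
  obtain ⟨Φ, hΦ, hB⟩ := h.exists_measurable_eq i
  have hV : Measurable fun ω (j : Finset.range i) => X j ω :=
    measurable_pi_lambda _ fun j => h.measurable_harvest j
  have h2 : IndepFun (fun ω (j : Finset.range i) => X j ω) (X i) P :=
    (h.indep_harvest.indepFun_finset (Finset.range i) {i} (by simp) h.measurable_harvest).comp
      measurable_id (measurable_pi_apply (⟨i, Finset.mem_singleton_self i⟩ : ({i} : Finset ℕ)))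
  have h1 : IndepFun (B 0) (fun ω => ((fun j : Finset.range i => X j ω), X i ω)) P :=
    h.indep_init.comp (φ := id)
      (ψ := fun x : ℕ → ℝ => ((fun j : Finset.range i => x j), x i)) measurable_id (by fun_prop)
  have h3 := IndepFun.prodMk_left_of_prodMk_right h.measurable_init hV (h.measurable_harvest i)
    h1 h2
  have hBi : B i = Φ ∘ fun ω => (B 0 ω, fun j : Finset.range i => X j ω) := funext hB
  rw [hBi]
  exact h3.comp hΦ measurable_id

lemma map_succ [IsProbabilityMeasure P] (h : IsStorageProcess P ν M X B) (i : ℕ) :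
    P.map (B (i + 1)) = nextLaw ν M (P.map (B i)) := by
  have hm : Measurable fun p : ℝ × ℝ => p.1 - (if M < p.1 then M else 0) + p.2 :=
    ((measurable_afterTransmit M).comp measurable_fst).add measurable_snd
  rw [nextLaw, ← h.law_harvest i, ← (indepFun_iff_map_prod_eq_prod_map_map
    (h.measurable_buffer i).aemeasurable (h.measurable_harvest i).aemeasurable).1
    (h.indepFun_harvest i), Measure.map_map hm
    ((h.measurable_buffer i).prodMk (h.measurable_harvest i))]
  congr 1
  funext ω
  exact h.step i ω

/-- From the first step on, the law of the buffer content has a density. -/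
lemma exists_density [IsProbabilityMeasure P] {a r : ℝ} (ha : 0 < a) (hr : 0 < r)
    (h : IsStorageProcess P (gammaMeasure a r) M X B) :
    ∃ f : ℝ → ℝ, Integrable f volIci ∧ (∀ x, 0 ≤ f x) ∧ ∫ x, f x ∂volIci = 1 ∧ ∀ i, P.map (B (i + 1)) =
      volIci.withDensity fun x => ENNReal.ofReal ((transfer volIci (stepDensity a r M))^[i] f x) := by
  have hP0 := Measure.isProbabilityMeasure_map (μ := P) (h.measurable_buffer 0).aemeasurable
  have hP1 := Measure.isProbabilityMeasure_map (μ := P) (h.measurable_buffer 1).aemeasurable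
  have hk := isMarkovDensity_stepDensity (M := M) ha hr
  have hsupp : P.map (B 0) (Iio 0) = 0 := by
    rw [Measure.map_apply (h.measurable_buffer 0) measurableSet_Iio, measure_eq_zero_iff_ae_notMem]
    filter_upwards [h.init_nonneg] with ω hω
    exact not_lt.2 hω
  set D : ℝ → ENNReal := fun y => ∫⁻ x, gammaPDF a r (y - afterTransmit M x) ∂(P.map (B 0)) with hD
  have h1 : P.map (B 1) = volIci.withDensity D := by
    rw [h.map_succ 0, nextLaw_eq_withDensity hsupp ha hr]
  have hDm : Measurable D := measurable_gammaPDF_sub.lintegral_prod_left'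
  have hD1 : ∫⁻ y, D y ∂volIci = 1 := by
    rw [← setLIntegral_univ, ← withDensity_apply _ MeasurableSet.univ, ← h1]
    exact measure_univ
  have hDne : ∫⁻ y, D y ∂volIci ≠ ⊤ := by rw [hD1]; exact ENNReal.one_ne_top
  -- The density from an arbitrary initial law may be infinite on a null set, which `toReal`
  -- discards.
  have hf : Integrable (fun y => (D y).toReal) volIci :=
    integrable_toReal_of_lintegral_ne_top hDm.aemeasurable hDne
  refine ⟨fun y => (D y).toReal, hf, fun y => ENNReal.toReal_nonneg, ?_, fun i => ?_⟩
  · rw [integral_toReal hDm.aemeasurable (ae_lt_top hDm hDne), hD1, ENNReal.toReal_one]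
  · induction i with
    | zero =>
      rw [zero_add, h1]
      refine withDensity_congr_ae ?_
      filter_upwards [ae_lt_top hDm hDne] with y hy
      exact (ENNReal.ofReal_toReal hy.ne).symm
    | succ i ih =>
      have hi := hk.integrable_iterate hf i
      have hnn : 0 ≤ᵐ[volIci] (transfer volIci (stepDensity a r M))^[i] fun y => (D y).toReal :=
        ae_of_all _ (hk.iterate_nonneg (fun y => ENNReal.toReal_nonneg) i)
      rw [h.map_succ (i + 1), ih, nextLaw_withDensity hi.aemeasurable hi hnn ha hr,
        Function.iterate_succ_apply']

end IsStorageProcess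

lemma withDensity_real_apply {f : ℝ → ℝ} (hf : Integrable f volIci) (h0 : 0 ≤ᵐ[volIci] f)
    {A : Set ℝ} (hA : MeasurableSet A) :
    (volIci.withDensity fun x => ENNReal.ofReal (f x)).real A = ∫ x in A, f x ∂volIci := by
  rw [measureReal_def, withDensity_apply _ hA,
    ← ofReal_integral_eq_lintegral_ofReal hf.integrableOn (ae_restrict_of_ae h0),
    ENNReal.toReal_ofReal (integral_nonneg_of_ae (ae_restrict_of_ae h0))]

/-- An invariant probability density of the storage process is its limiting pdf. -/
theorem isLimitingPdf_of_invariant {a r M : ℝ} (ha : 1 ≤ a) (hr : 0 < r) (hM : 0 < M) {g : ℝ → ℝ}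
    (hgm : Measurable g) (hg0 : ∀ x, 0 ≤ x → 0 ≤ g x) (hg : Integrable g volIci)
    (hg1 : ∫ x, g x ∂volIci = 1) (hinv : transfer volIci (stepDensity a r M) g =ᵐ[volIci] g) :
    IsLimitingPdf.{u} (gammaMeasure a r) M g := by
  have ha0 : 0 < a := by linarith
  have hk := isMarkovDensity_stepDensity (M := M) ha0 hr
  have hgnn : 0 ≤ᵐ[volIci] g := by
    filter_upwards [ae_restrict_mem measurableSet_Ici] with x hx using hg0 x hx
  have hgpos : ∀ᵐ x ∂volIci, 0 < g x :=
    hk.pos_of_invariant (fun h hh h0 hi hI => pos_of_stepDensity_invariant ha0 hr hM hh h0 hi hI)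
      hg hinv (by rw [hg1]; exact one_pos)
  refine ⟨hgm, hg0, ⟨?_⟩, ?_, ?_, ?_⟩
  · rw [withDensity_apply _ MeasurableSet.univ, Measure.restrict_univ,
      ← ofReal_integral_eq_lintegral_ofReal hg hgnn, hg1, ENNReal.ofReal_one]
  · refine withDensity_absolutelyContinuous _ _ ?_
    rw [Measure.restrict_apply measurableSet_Iio]
    convert measure_empty (μ := (volume : Measure ℝ))
    ext x; simp
  · rw [nextLaw_withDensity hgm.aemeasurable hg hgnn ha0 hr]
    refine withDensity_congr_ae ?_
    filter_upwards [hinv] with x hx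
    rw [hx]
  · intro Ω _ P _ X B h
    obtain ⟨f, hf, hf0, hf1, hlaw⟩ := h.exists_density ha0 hr
    have hlim := hk.tendsto_integral_abs_iterate hg hgpos hg1 hinv
      (fun ε hε => stepDensity_minorized ha hr hM hg hε) hf hf1
    rw [Metric.tendstoUniformlyOn_iff]
    intro ε hε
    obtain ⟨N, hN⟩ := eventually_atTop.1 (hlim.eventually (gt_mem_nhds hε))
    -- Densities exist only from time 1, whence the shift. The difference of probabilities of any
    -- event is at most the L¹ distance.
    refine eventually_atTop.2 ⟨N + 1, fun i hi A hA => ?_⟩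
    obtain ⟨j, rfl⟩ : ∃ j, i = j + 1 := ⟨i - 1, by omega⟩
    have hfj := hk.integrable_iterate hf j
    rw [hlaw j, withDensity_real_apply hg hgnn hA,
      withDensity_real_apply hfj (ae_of_all _ (hk.iterate_nonneg hf0 j)) hA, dist_comm,
      Real.dist_eq, ← integral_sub hfj.integrableOn hg.integrableOn]
    calc |∫ x in A, ((transfer volIci (stepDensity a r M))^[j] f x - g x) ∂volIci|
        ≤ ∫ x in A, |(transfer volIci (stepDensity a r M))^[j] f x - g x| ∂volIci :=
          abs_integral_le_integral_abs
      _ ≤ ∫ x, |(transfer volIci (stepDensity a r M))^[j] f x - g x| ∂volIci :=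
          setIntegral_le_integral (hfj.sub hg).abs (ae_of_all _ fun x => abs_nonneg _)
      _ < ε := hN j (by omega)

/-! ### The principal branch of the Lambert function -/

/-- Below π/2 this is t < tan t; beyond, the cosine is nonpositive. It keeps the boundary curve of
`lambertRange` in the half-plane of real part at least -1. -/
lemma mul_cot_le_one {t : ℝ} (h0 : 0 < t) (hpi : t < Real.pi) : t * Real.cot t ≤ 1 := by
  have hs := Real.sin_pos_of_pos_of_lt_pi h0 hpi
  rw [Real.cot_eq_cos_div_sin, ← mul_div_assoc, div_le_one hs]
  rcases le_or_gt (Real.pi / 2) t with h | h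
  · exact (mul_nonpos_of_nonneg_of_nonpos h0.le
      (Real.cos_nonpos_of_pi_div_two_le_of_le h (by linarith))).trans hs.le
  · have hc := Real.cos_pos_of_mem_Ioo (x := t) ⟨by linarith, h⟩
    have := Real.lt_tan h0 h
    rw [Real.tan_eq_sin_div_cos, lt_div_iff₀ hc] at this
    exact this.le

lemma neg_one_le_re_of_mem_lambertRange {w : ℂ} (hw : w ∈ lambertRange) : -1 ≤ w.re := by
  rcases hw with ⟨-, h⟩ | ⟨h0, hpi, h⟩ | ⟨hpi, h0, h⟩
  · exact h
  · have := mul_cot_le_one h0 hpi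
    linarith
  · have := mul_cot_le_one (t := -w.im) (by linarith) (by linarith)
    rw [Real.cot_eq_cos_div_sin, Real.cos_neg, Real.sin_neg, div_neg, ← Real.cot_eq_cos_div_sin] at this
    linarith

/-- After squaring, s² < 1 - t² reduces the claim to sin² t < t². It places the open unit disc
inside `lambertRange`. -/
lemma abs_lt_mul_cot {s t : ℝ} (ht : 0 < t) (hst : s ^ 2 + t ^ 2 < 1) : |s| < t * Real.cot t := by
  have ht1 : t < 1 := by nlinarith [sq_nonneg s]
  have hpi := Real.pi_gt_three
  have hs := Real.sin_pos_of_pos_of_lt_pi ht (by linarith)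
  have hc := Real.cos_pos_of_mem_Ioo (x := t) ⟨by linarith, by linarith⟩
  rw [Real.cot_eq_cos_div_sin, ← mul_div_assoc, lt_div_iff₀ hs]
  refine lt_of_pow_lt_pow_left₀ 2 (by positivity) ?_
  have h1 := Real.sin_lt ht
  have h2 := Real.sin_sq_add_cos_sq t
  rw [mul_pow, mul_pow, sq_abs]
  nlinarith [mul_pos hs hs]

lemma mem_lambertRange_of_norm_lt_one {w : ℂ} (hw : ‖w‖ < 1) : w ∈ lambertRange := by
  have hsq : w.re ^ 2 + w.im ^ 2 < 1 := by
    have h1 := Complex.sq_norm w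
    rw [Complex.normSq_apply] at h1
    nlinarith [norm_nonneg w]
  have hpi := Real.pi_gt_three
  have him := (abs_le.1 ((Complex.abs_im_le_norm w).trans hw.le))
  rcases lt_trichotomy w.im 0 with h | h | h
  · right; right
    have := abs_lt_mul_cot (s := w.re) (t := -w.im) (by linarith) (by linarith [neg_sq w.im])
    rw [Real.cot_eq_cos_div_sin, Real.cos_neg, Real.sin_neg, div_neg, ← Real.cot_eq_cos_div_sin] at this
    exact ⟨by linarith, h, by linarith [neg_abs_le w.re]⟩
  · left
    exact ⟨h, (abs_le.1 ((Complex.abs_re_le_norm w).trans hw.le)).1⟩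
  · right; left
    have := abs_lt_mul_cot (s := w.re) h hsq
    exact ⟨h, by linarith, by linarith [neg_abs_le w.re]⟩

lemma exists_lt_one_le_mul_exp_neg {a : ℝ} (ha : a < Real.exp (-1)) :
    ∃ r : ℝ, 0 < r ∧ r < 1 ∧ a ≤ r * Real.exp (-r) := by
  have hc : Continuous fun r : ℝ => r * Real.exp (-r) := by fun_prop
  have h1 : ∀ᶠ r in 𝓝[<] (1 : ℝ), a < r * Real.exp (-r) :=
    (hc.continuousWithinAt (s := Iio 1)).eventually_const_lt (by simpa using ha)
  have h2 : ∀ᶠ r in 𝓝[<] (1 : ℝ), r ∈ Ioo (0 : ℝ) 1 := Ioo_mem_nhdsLT one_pos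
  obtain ⟨r, hr, hr'⟩ := (h1.and h2).exists
  exact ⟨r, hr'.1, hr'.2, hr.le⟩

/-- Banach's fixed point theorem for w ↦ z exp(-w) on a disc of radius r < 1: the bound |z| ≤ r
exp(-r) makes the disc invariant and r a Lipschitz constant. -/
lemma exists_mul_exp_eq {z : ℂ} (hz : ‖z‖ < Real.exp (-1)) :
    ∃ w : ℂ, ‖w‖ < 1 ∧ w * Complex.exp w = z := by
  obtain ⟨r, hr0, hr1, hr⟩ := exists_lt_one_le_mul_exp_neg hz
  have hzr : ‖z‖ * Real.exp r ≤ r := by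
    calc ‖z‖ * Real.exp r ≤ r * Real.exp (-r) * Real.exp r := by gcongr
      _ = r := by rw [mul_assoc, ← Real.exp_add]; simp
  set F : ℂ → ℂ := fun w => z * Complex.exp (-w) with hF
  have hbound : ∀ w ∈ Metric.closedBall (0 : ℂ) r, ‖z * Complex.exp (-w)‖ ≤ r := by
    intro w hw
    rw [mem_closedBall_zero_iff] at hw
    rw [norm_mul, Complex.norm_exp]
    refine le_trans ?_ hzr
    gcongr
    have := (abs_le.1 ((Complex.abs_re_le_norm w).trans hw)).1
    simp only [Complex.neg_re]
    linarith
  have hmaps : MapsTo F (Metric.closedBall 0 r) (Metric.closedBall 0 r) := fun w hw =>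
    mem_closedBall_zero_iff.2 (hbound w hw)
  have hderiv : ∀ w, HasDerivAt F (-(z * Complex.exp (-w))) w := by
    intro w
    have := ((hasDerivAt_neg w).cexp).const_mul z
    simpa [hF] using this
  have hlip : LipschitzOnWith r.toNNReal F (Metric.closedBall 0 r) := by
    refine (convex_closedBall 0 r).lipschitzOnWith_of_nnnorm_hasDerivWithin_le
      (fun w _ => (hderiv w).hasDerivWithinAt) fun w hw => ?_
    rw [← NNReal.coe_le_coe, coe_nnnorm, norm_neg, Real.coe_toNNReal _ hr0.le]
    exact hbound w hw
  have hcontr : ContractingWith r.toNNReal (hmaps.restrict F _ _) :=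
    ⟨by rw [← NNReal.coe_lt_coe, Real.coe_toNNReal _ hr0.le]; exact hr1, hlip.mapsToRestrict hmaps⟩
  obtain ⟨w, hw, hfix, -⟩ := ContractingWith.exists_fixedPoint' Metric.isClosed_closedBall.isComplete
    hmaps hcontr (x := 0) (Metric.mem_closedBall_self hr0.le) (edist_ne_top _ _)
  refine ⟨w, (mem_closedBall_zero_iff.1 hw).trans_lt hr1, ?_⟩
  have h1 : z * Complex.exp (-w) = w := hfix
  calc w * Complex.exp w = z * Complex.exp (-w) * Complex.exp w := by rw [h1]
    _ = z := by rw [mul_assoc, ← Complex.exp_add]; simp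

/-- Membership in the range and the defining equation suffice below; injectivity of w ↦ w exp w on
the range plays no role. -/
lemma lambertW0_spec {z : ℂ} (hz : ‖z‖ < Real.exp (-1)) :
    lambertW0 z ∈ lambertRange ∧ lambertW0 z * Complex.exp (lambertW0 z) = z := by
  obtain ⟨w, hw, hwz⟩ := exists_mul_exp_eq hz
  have h : ∃ w ∈ lambertRange, w * Complex.exp w = z :=
    ⟨w, mem_lambertRange_of_norm_lt_one hw, hwz⟩
  exact ⟨Function.invFunOn_mem h, Function.invFunOn_eq h⟩

/-! ### Roots of unity and the numbers `λ_n` -/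

lemma expEta_eq_pow (m k : ℕ) : expEta m k = Complex.exp (2 * Real.pi * Complex.I / m) ^ k := by
  rw [expEta, ← Complex.exp_nat_mul]
  congr 1
  ring

lemma isPrimitiveRoot_exp_two_pi {m : ℕ} (hm : 1 ≤ m) :
    IsPrimitiveRoot (Complex.exp (2 * Real.pi * Complex.I / m)) m :=
  Complex.isPrimitiveRoot_exp m (by omega)

lemma expEta_pow_self {m : ℕ} (hm : 1 ≤ m) (k : ℕ) : expEta m k ^ m = 1 := by
  rw [expEta_eq_pow, ← pow_mul, mul_comm k m, pow_mul, (isPrimitiveRoot_exp_two_pi hm).pow_eq_one,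
    one_pow]

lemma norm_expEta (m k : ℕ) : ‖expEta m k‖ = 1 := by
  rw [expEta, Complex.norm_exp]
  simp [← Complex.ofReal_natCast, ← Complex.ofReal_ofNat, ← Complex.ofReal_mul,
    ← Complex.ofReal_div]

lemma expEta_ne_zero (m k : ℕ) : expEta m k ≠ 0 := Complex.exp_ne_zero _

lemma expEta_inv (m k : ℕ) : (expEta m k)⁻¹ = conj (expEta m k) := by
  rw [Complex.inv_def, Complex.normSq_eq_norm_sq, norm_expEta]
  simp

lemma expEta_zero (m : ℕ) : expEta m 0 = 1 := by simp [expEta]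

lemma expEta_injOn {m : ℕ} (hm : 1 ≤ m) {k k' : ℕ} (hk : k < m) (hk' : k' < m)
    (h : expEta m k = expEta m k') : k = k' := by
  rw [expEta_eq_pow, expEta_eq_pow] at h
  exact (isPrimitiveRoot_exp_two_pi hm).pow_inj hk hk' h

/-- The ratio `y_n = (λ - λ_n) / λ`. -/
def ratio (m : ℕ) (Xbar M : ℝ) (n : ℕ) : ℂ :=
  -(lambertW0 (-((M / Xbar : ℝ) : ℂ) * Complex.exp (-((M / Xbar : ℝ) : ℂ)) *
      Complex.exp (-(2 * Real.pi * n / m * Complex.I)))) / ((M / Xbar : ℝ) : ℂ)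

section

variable {m : ℕ} (hm : 1 ≤ m) {Xbar M : ℝ} (hX : 0 < Xbar) (hM : Xbar < M)
include hm hX hM

omit hm in
lemma lam_eq (n : ℕ) : lam m Xbar M n = rate m Xbar * (1 - ratio m Xbar M n) := by
  have hX' : (Xbar : ℂ) ≠ 0 := by exact_mod_cast hX.ne'
  have hM' : (M : ℂ) ≠ 0 := by exact_mod_cast (hX.trans hM).ne'
  simp only [lam, ratio, rate]
  generalize lambertW0 _ = w
  push_cast
  field_simp
  ring

omit hm in
lemma lambertW0_ratio (n : ℕ) :
    -(ratio m Xbar M n * ((M / Xbar : ℝ) : ℂ)) ∈ lambertRange ∧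
    ratio m Xbar M n * Complex.exp (-(ratio m Xbar M n * ((M / Xbar : ℝ) : ℂ))) =
      Complex.exp (-((M / Xbar : ℝ) : ℂ)) * (expEta m n)⁻¹ := by
  set δ := M / Xbar with hδ
  have hδ1 : 1 < δ := (one_lt_div hX).2 hM
  have hδ0 : (δ : ℂ) ≠ 0 := by exact_mod_cast (by linarith : δ ≠ 0)
  have he : Complex.exp (-(2 * Real.pi * n / m * Complex.I)) = (expEta m n)⁻¹ := by
    rw [Complex.exp_neg, expEta]
  have hz : ‖-(δ : ℂ) * Complex.exp (-(δ : ℂ)) * Complex.exp (-(2 * Real.pi * n / m * Complex.I))‖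
      < Real.exp (-1) := by
    rw [he, norm_mul, norm_mul, norm_inv, norm_expEta, norm_neg, Complex.norm_real,
      Complex.norm_exp, Real.norm_of_nonneg (by linarith), Complex.neg_re, Complex.ofReal_re]
    -- For δ > 1, δ exp(-δ) < exp(-1), by δ < exp(δ - 1): the argument lies in the disc covered by
    -- `lambertW0_spec`.
    have h1 := Real.add_one_lt_exp (x := δ - 1) (by linarith)
    have h2 : Real.exp (δ - 1) * Real.exp (-δ) = Real.exp (-1) := by
      rw [← Real.exp_add]; congr 1; ring
    rw [← h2]
    have := Real.exp_pos (-δ)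
    nlinarith
  obtain ⟨h1, h2⟩ := lambertW0_spec hz
  simp only [ratio, ← hδ]
  rw [he] at h1 h2 ⊢
  generalize lambertW0 _ = w at *
  have e1 : -(-w / (δ : ℂ) * δ) = w := by field_simp
  rw [e1]
  refine ⟨h1, ?_⟩
  have h3 : -w / (δ : ℂ) * Complex.exp w = -(w * Complex.exp w) / δ := by ring
  rw [h3, h2]
  field_simp

omit hm in
lemma ratio_ne_zero (n : ℕ) : ratio m Xbar M n ≠ 0 := by
  intro h
  have := (lambertW0_ratio (m := m) hX hM n).2
  rw [h, zero_mul] at this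
  exact mul_ne_zero (Complex.exp_ne_zero _) (inv_ne_zero (expEta_ne_zero _ _)) this.symm

-- Re W₀ ≥ -1 gives δ Re y ≤ 1 < δ, whereas |y| exp(-δ Re y) = exp(-δ); so |y| < 1.
omit hm in
lemma norm_ratio_lt_one (n : ℕ) : ‖ratio m Xbar M n‖ < 1 := by
  obtain ⟨h1, h2⟩ := lambertW0_ratio (m := m) hX hM n
  have hδ1 : 1 < M / Xbar := (one_lt_div hX).2 hM
  have h3 := neg_one_le_re_of_mem_lambertRange h1
  have h4 := congrArg norm h2
  rw [norm_mul, norm_mul, norm_inv, norm_expEta, Complex.norm_exp, Complex.norm_exp, inv_one,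
    mul_one, Complex.neg_re (((M / Xbar : ℝ) : ℂ)), Complex.ofReal_re] at h4
  by_contra hcon
  have h5 : Real.exp (-(M / Xbar)) <
      Real.exp (-(ratio m Xbar M n * ((M / Xbar : ℝ) : ℂ))).re := Real.exp_lt_exp.2 (by linarith)
  have h6 := Real.exp_pos (-(ratio m Xbar M n * ((M / Xbar : ℝ) : ℂ))).re
  nlinarith

/-- The m-th power of the Lambert equation, in which the root of unity disappears. This identity
matches the exponentials across the shift by M. -/
lemma ratio_pow (n : ℕ) :
    ratio m Xbar M n ^ m = Complex.exp (-(lam m Xbar M n * M)) := by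
  have h2 := (lambertW0_ratio (m := m) hX hM n).2
  have h3 : ratio m Xbar M n = Complex.exp (ratio m Xbar M n * ((M / Xbar : ℝ) : ℂ)) *
      (Complex.exp (-((M / Xbar : ℝ) : ℂ)) * (expEta m n)⁻¹) := by
    rw [← h2, mul_left_comm, ← Complex.exp_add]; simp
  conv_lhs => rw [h3]
  rw [mul_pow, mul_pow, inv_pow, expEta_pow_self hm, inv_one, mul_one, ← Complex.exp_nat_mul,
    ← Complex.exp_nat_mul, ← Complex.exp_add, lam_eq hX hM, rate]
  have hX' : (Xbar : ℂ) ≠ 0 := by exact_mod_cast hX.ne'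
  congr 1
  push_cast
  field_simp
  ring

lemma ratio_injOn {n n' : ℕ} (hn : n < m) (hn' : n' < m)
    (h : ratio m Xbar M n = ratio m Xbar M n') : n = n' := by
  have h1 := (lambertW0_ratio (m := m) hX hM n).2
  have h2 := (lambertW0_ratio (m := m) hX hM n').2
  rw [h, h2] at h1
  have h3 := mul_left_cancel₀ (Complex.exp_ne_zero _) h1
  exact expEta_injOn hm hn hn' (inv_injective h3).symm

end

/-! ### Sums over roots of unity -/

section RootSums

variable {m : ℕ} (hm : 1 ≤ m)
include hm

lemma sum_expEta_div {q t : ℕ} (hq : q < m) (ht : t < m) :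
    1 / (m : ℂ) * ∑ k ∈ Finset.range m, expEta m k ^ q / expEta m k ^ t = if q = t then 1 else 0 := by
  have hm0 : (m : ℂ) ≠ 0 := by exact_mod_cast (by omega : m ≠ 0)
  split_ifs with h
  · subst h
    rw [Finset.sum_congr rfl fun k _ => div_self (pow_ne_zero q (expEta_ne_zero m k))]
    simp [hm0]
  · set ζ := Complex.exp (2 * Real.pi * Complex.I / m) with hζ
    have hprim : IsPrimitiveRoot ζ m := isPrimitiveRoot_exp_two_pi hm
    have hζ0 : ζ ≠ 0 := Complex.exp_ne_zero _
    have h1 : ∀ k, expEta m k ^ q / expEta m k ^ t = (ζ ^ q / ζ ^ t) ^ k := by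
      intro k
      rw [expEta_eq_pow, div_pow, ← pow_mul, ← pow_mul, ← pow_mul, ← pow_mul, mul_comm k q,
        mul_comm k t]
    have h2 : ζ ^ q / ζ ^ t ≠ 1 := by
      rw [Ne, div_eq_one_iff_eq (pow_ne_zero _ hζ0)]
      exact fun h' => h (hprim.pow_inj hq ht h')
    have h3 : (ζ ^ q / ζ ^ t) ^ m = 1 := by
      rw [div_pow, ← pow_mul, ← pow_mul, mul_comm q m, mul_comm t m, pow_mul, pow_mul,
        hprim.pow_eq_one, one_pow, one_pow, div_one]
    rw [Finset.sum_congr rfl fun k _ => h1 k, geom_sum_eq h2, h3, sub_self, zero_div, mul_zero]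

lemma expEta_conj_index {k : ℕ} (hk : k < m) :
    conj (expEta m k) = expEta m ((m - k) % m) := by
  rw [← expEta_inv]
  refine inv_eq_of_mul_eq_one_right ?_
  rcases Nat.eq_zero_or_pos k with rfl | hk0
  · simp [expEta_zero]
  · rw [Nat.mod_eq_of_lt (by omega), expEta_eq_pow, expEta_eq_pow, ← pow_add,
      Nat.add_sub_cancel' hk.le]
    exact (isPrimitiveRoot_exp_two_pi hm).pow_eq_one

lemma sum_conj_expEta (F : ℂ → ℂ) :
    ∑ k ∈ Finset.range m, F (conj (expEta m k)) = ∑ k ∈ Finset.range m, F (expEta m k) := by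
  refine Finset.sum_nbij' (fun k => (m - k) % m) (fun k => (m - k) % m) ?_ ?_ ?_ ?_ ?_
  · exact fun k _ => Finset.mem_range.2 (Nat.mod_lt _ (by omega))
  · exact fun k _ => Finset.mem_range.2 (Nat.mod_lt _ (by omega))
  · intro k hk
    rw [Finset.mem_range] at hk
    rcases Nat.eq_zero_or_pos k with rfl | hk0
    · simp
    · rw [Nat.mod_eq_of_lt (by omega : m - k < m), Nat.mod_eq_of_lt (by omega)]; omega
  · intro k hk
    rw [Finset.mem_range] at hk
    rcases Nat.eq_zero_or_pos k with rfl | hk0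
    · simp
    · rw [Nat.mod_eq_of_lt (by omega : m - k < m), Nat.mod_eq_of_lt (by omega)]; omega
  · intro k hk
    rw [expEta_conj_index hm (Finset.mem_range.1 hk)]

/-- The set of m-th roots of unity is closed under conjugation, so imaginary parts cancel in the sum
and the real parts of the statement can be dropped. -/
lemma sum_re_expEta {F : ℂ → ℂ} (hF : ∀ z, F (conj z) = conj (F z)) :
    ∑ k ∈ Finset.range m, ((F (expEta m k)).re : ℂ) = ∑ k ∈ Finset.range m, F (expEta m k) := by
  have h1 : ∀ z : ℂ, (z.re : ℂ) = (1 / 2) * (z + conj z) := fun z => by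
    rw [Complex.re_eq_add_conj]; ring
  simp only [h1, ← Finset.mul_sum, Finset.sum_add_distrib, ← hF, sum_conj_expEta hm F]
  ring

/-- The weights of the partial fraction decomposition of `1 / (1 - y ^ m)`. -/
def rootWeight (m : ℕ) (y : ℂ) (k : ℕ) : ℂ := 1 / m * (expEta m k / (expEta m k - y))

variable {y : ℂ} (hy : ‖y‖ < 1)
include hy

omit hm in
lemma expEta_sub_ne_zero (k : ℕ) : expEta m k - y ≠ 0 := by
  intro h
  rw [sub_eq_zero] at h
  rw [← h, norm_expEta] at hy
  exact lt_irrefl _ hy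

lemma one_sub_pow_ne_zero : 1 - y ^ m ≠ 0 := by
  intro h
  rw [sub_eq_zero] at h
  have h1 : ‖y‖ ^ m = 1 := by rw [← norm_pow, ← h, norm_one]
  exact (pow_lt_one₀ (norm_nonneg y) hy (by omega)).ne h1

/-- A finite geometric series in y / exp(j η_k), whose m-th power is y^m. -/
lemma one_sub_pow_mul_rootWeight (k : ℕ) :
    (1 - y ^ m) * rootWeight m y k = 1 / m * ∑ j ∈ Finset.range m, y ^ j / expEta m k ^ j := by
  have he := expEta_ne_zero m k
  have hs := expEta_sub_ne_zero (m := m) hy k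
  have h1 : (∑ j ∈ Finset.range m, (y / expEta m k) ^ j) * (1 - y / expEta m k) = 1 - y ^ m := by
    have := geom_sum_mul (y / expEta m k) m
    rw [div_pow, expEta_pow_self hm, div_one] at this
    linear_combination -this
  have h2 : 1 - y / expEta m k = (expEta m k - y) / expEta m k := by field_simp
  rw [h2] at h1
  simp only [← div_pow, ← h1, rootWeight]
  field_simp

/-- Expanding each weight as a geometric sum, orthogonality of the roots of unity selects the
exponent t. Up to 1 - y^m, the weights evaluate polynomials of degree below m at y. -/
lemma sum_rootWeight_mul_pow {t : ℕ} (ht : t < m) :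
    (1 - y ^ m) * ∑ k ∈ Finset.range m, rootWeight m y k * expEta m k ^ t = y ^ t := by
  calc (1 - y ^ m) * ∑ k ∈ Finset.range m, rootWeight m y k * expEta m k ^ t
      = ∑ k ∈ Finset.range m, ∑ j ∈ Finset.range m,
          y ^ j * (1 / m * (expEta m k ^ t / expEta m k ^ j)) := by
        rw [Finset.mul_sum]
        refine Finset.sum_congr rfl fun k _ => ?_
        rw [← mul_assoc, one_sub_pow_mul_rootWeight hm hy, Finset.mul_sum, Finset.sum_mul]
        refine Finset.sum_congr rfl fun j _ => ?_
        ring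
    _ = ∑ j ∈ Finset.range m, y ^ j * (if t = j then 1 else 0) := by
        rw [Finset.sum_comm]
        refine Finset.sum_congr rfl fun j hj => ?_
        rw [← sum_expEta_div hm ht (Finset.mem_range.1 hj), Finset.mul_sum, Finset.mul_sum]
    _ = y ^ t := by simp [ht]

lemma sum_rootWeight : (1 - y ^ m) * ∑ k ∈ Finset.range m, rootWeight m y k = 1 := by
  simpa using sum_rootWeight_mul_pow hm hy (t := 0) (by omega)

lemma sum_pow_mul_sum_div (Z : ℕ → ℂ) :
    ∑ t ∈ Finset.range m, y ^ t * (1 / m * ∑ k ∈ Finset.range m, Z k / expEta m k ^ t) =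
      (1 - y ^ m) * ∑ k ∈ Finset.range m, rootWeight m y k * Z k := by
  rw [Finset.mul_sum]
  simp only [← mul_assoc, one_sub_pow_mul_rootWeight hm hy, Finset.mul_sum, Finset.sum_mul]
  rw [Finset.sum_comm]
  refine Finset.sum_congr rfl fun k _ => Finset.sum_congr rfl fun t _ => ?_
  ring

/-- The combination of exponentials and powers common to the density below `M`, to `D_n` and to
`B_{sn}`, in closed form: `P`, `Z k` and `T t` are the values of a linear functional at
`exp (-λ_n x)`, `exp (-θ_k x)` and `x ^ t * exp (-λ x)`. -/
lemma bracket_eq {l : ℂ} (hl : l ≠ 0) (P : ℂ) (Z T : ℕ → ℂ) :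
    P + ∑ k ∈ Finset.range m, rootWeight m y k * (Z k - P)
      - ∑ t ∈ Finset.range m, (l * y) ^ t / (t.factorial : ℂ) *
        (T t + 1 / m * ∑ k ∈ Finset.range m, ((l * expEta m k) ^ t)⁻¹ * (t.factorial : ℂ) *
          (Z k - ∑ q ∈ Finset.range (t + 1), (l * expEta m k) ^ q / (q.factorial : ℂ) * T q)) =
    y ^ m * ∑ k ∈ Finset.range m, rootWeight m y k * (Z k - P) := by
  have hinner : ∀ t ∈ Finset.range m, (l * y) ^ t / (t.factorial : ℂ) *
        (T t + 1 / m * ∑ k ∈ Finset.range m, ((l * expEta m k) ^ t)⁻¹ * (t.factorial : ℂ) *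
          (Z k - ∑ q ∈ Finset.range (t + 1), (l * expEta m k) ^ q / (q.factorial : ℂ) * T q)) =
      y ^ t * (1 / m * ∑ k ∈ Finset.range m, Z k / expEta m k ^ t) := by
    intro t ht
    rw [Finset.mem_range] at ht
    have hf : ∀ q : ℕ, (q.factorial : ℂ) ≠ 0 := fun q => by exact_mod_cast q.factorial_ne_zero
    -- Averaging over the roots keeps only q = t in the Taylor polynomial, since q ≤ t < m; this
    -- cancels the separate term `T t`.
    have h1 : 1 / (m : ℂ) * ∑ k ∈ Finset.range m, ((l * expEta m k) ^ t)⁻¹ * (t.factorial : ℂ) *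
          ∑ q ∈ Finset.range (t + 1), (l * expEta m k) ^ q / (q.factorial : ℂ) * T q = T t := by
      calc _ = ∑ q ∈ Finset.range (t + 1), (t.factorial : ℂ) / q.factorial * l ^ q / l ^ t * T q *
            (1 / m * ∑ k ∈ Finset.range m, expEta m k ^ q / expEta m k ^ t) := by
            simp only [Finset.mul_sum]
            rw [Finset.sum_comm]
            refine Finset.sum_congr rfl fun q _ => Finset.sum_congr rfl fun k _ => ?_
            simp only [mul_pow, mul_inv]
            field_simp
        _ = ∑ q ∈ Finset.range (t + 1), (t.factorial : ℂ) / q.factorial * l ^ q / l ^ t * T q *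
            (if q = t then 1 else 0) := by
            refine Finset.sum_congr rfl fun q hq => ?_
            rw [Finset.mem_range] at hq
            rw [sum_expEta_div hm (by omega) ht]
        _ = T t := by
            simp only [mul_ite, mul_one, mul_zero]
            rw [Finset.sum_ite_eq' (Finset.range (t + 1)) t, if_pos (Finset.self_mem_range_succ t),
              div_self (hf t), one_mul, div_self (pow_ne_zero _ hl), one_mul]
    simp only [mul_sub, Finset.sum_sub_distrib]
    rw [h1]
    have h2 : T t + (1 / (m : ℂ) * ∑ k ∈ Finset.range m, ((l * expEta m k) ^ t)⁻¹ *
        (t.factorial : ℂ) * Z k - T t) = (t.factorial : ℂ) / l ^ t *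
        (1 / m * ∑ k ∈ Finset.range m, Z k / expEta m k ^ t) := by
      rw [add_sub_cancel]
      simp only [Finset.mul_sum]
      refine Finset.sum_congr rfl fun k _ => ?_
      simp only [mul_pow, mul_inv]
      field_simp
    rw [h2, mul_pow]
    have := hf t
    have := pow_ne_zero t hl
    field_simp
  rw [Finset.sum_congr rfl hinner, sum_pow_mul_sum_div hm hy]
  simp only [mul_sub, Finset.sum_sub_distrib, ← Finset.sum_mul]
  linear_combination -P * sum_rootWeight hm hy

end RootSums

/-! ### The coefficients `a_{nk}` and `b_{nk}` -/

section Coeff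

variable {m : ℕ} (hm : 1 ≤ m) {Xbar M : ℝ} (hX : 0 < Xbar) (hM : Xbar < M)
include hm hX

lemma rate_pos : 0 < rate m Xbar := by
  have : (0 : ℝ) < m := by exact_mod_cast hm
  exact div_pos this hX

lemma rate_ne_zero : (rate m Xbar : ℂ) ≠ 0 := by exact_mod_cast (rate_pos hm hX).ne'

include hM

/-- The denominator of a_{nk} is 2λ(exp(j η_k) - y) / exp(j η_k), and that of b_{nk} is the same
with the root conjugated. Reindexing by conjugation merges both halves into `rootWeight`. -/
lemma sum_coeff (n : ℕ) (F : ℂ → ℂ) (P : ℂ) :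
    (rate m Xbar : ℂ) / m * ∑ k ∈ Finset.range m,
      (coeffA m Xbar M n k * F (expEta m k) + coeffB m Xbar M n k * F (conj (expEta m k))
        - (coeffA m Xbar M n k + coeffB m Xbar M n k) * P) =
    ∑ k ∈ Finset.range m, rootWeight m (ratio m Xbar M n) k * (F (expEta m k) - P) := by
  set l : ℂ := (rate m Xbar : ℂ) with hl
  set y := ratio m Xbar M n with hy
  have hl0 : l ≠ 0 := rate_ne_zero hm hX
  have hm0 : (m : ℂ) ≠ 0 := by exact_mod_cast (by omega : m ≠ 0)
  have hlam : lam m Xbar M n = l * (1 - y) := lam_eq hX hM n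
  have hA : ∀ k, coeffA m Xbar M n k = (2 * (l * (1 - y) * conj (expEta m k) +
      l * (1 - conj (expEta m k))))⁻¹ := by
    intro k
    simp only [coeffA, hlam, theta, expEta_inv, map_mul, map_sub, map_one, ← hl]
    rw [hl, Complex.conj_ofReal]
  have hB : ∀ k, coeffB m Xbar M n k = (2 * (l * (1 - y) * expEta m k +
      l * (1 - expEta m k)))⁻¹ := by
    intro k
    simp only [coeffB, hlam, theta, ← hl]
  have hswap := sum_conj_expEta hm fun z =>
    (2 * (l * (1 - y) * conj z + l * (1 - conj z)))⁻¹ * (F z - P)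
  simp only [Complex.conj_conj] at hswap
  have hsum : ∑ k ∈ Finset.range m,
      (coeffA m Xbar M n k * F (expEta m k) + coeffB m Xbar M n k * F (conj (expEta m k))
        - (coeffA m Xbar M n k + coeffB m Xbar M n k) * P) =
      ∑ k ∈ Finset.range m, 2 * coeffA m Xbar M n k * (F (expEta m k) - P) := by
    calc _ = ∑ k ∈ Finset.range m, (coeffA m Xbar M n k * (F (expEta m k) - P) +
          coeffB m Xbar M n k * (F (conj (expEta m k)) - P)) :=
          Finset.sum_congr rfl fun k _ => by ring
      _ = _ := by
          rw [Finset.sum_add_distrib]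
          simp only [hB]
          rw [hswap, ← Finset.sum_add_distrib]
          refine Finset.sum_congr rfl fun k _ => ?_
          rw [hA]
          ring
  rw [hsum, Finset.mul_sum]
  refine Finset.sum_congr rfl fun k _ => ?_
  have he := expEta_ne_zero m k
  have hs := expEta_sub_ne_zero (m := m) (norm_ratio_lt_one (m := m) hX hM n) k
  rw [← hy] at hs
  have h1 : l * (1 - y) * conj (expEta m k) + l * (1 - conj (expEta m k)) =
      l * (expEta m k - y) / expEta m k := by
    rw [← expEta_inv]
    field_simp
    ring
  rw [hA, h1, rootWeight]
  field_simp

end Coeff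

/-! ### The lower incomplete Gamma function -/

lemma hasDerivAt_exp_neg_mul_sum (t : ℕ) (w : ℂ) :
    HasDerivAt (fun w : ℂ => Complex.exp (-w) * ∑ q ∈ Finset.range (t + 1), w ^ q / (q.factorial : ℂ))
      (-(Complex.exp (-w) * w ^ t / (t.factorial : ℂ))) w := by
  have hexp : HasDerivAt (fun w : ℂ => Complex.exp (-w)) (-Complex.exp (-w)) w := by
    simpa using (hasDerivAt_neg w).cexp
  induction t with
  | zero => simpa using hexp
  | succ t ih =>
    have hf : (t.factorial : ℂ) ≠ 0 := by exact_mod_cast t.factorial_ne_zero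
    have ht : (t : ℂ) + 1 ≠ 0 := by exact_mod_cast t.succ_ne_zero
    have h1 : HasDerivAt (fun w : ℂ => Complex.exp (-w) * (w ^ (t + 1) / ((t + 1).factorial : ℂ)))
        (-Complex.exp (-w) * (w ^ (t + 1) / ((t + 1).factorial : ℂ)) +
          Complex.exp (-w) * (((t + 1 : ℕ) : ℂ) * w ^ t / ((t + 1).factorial : ℂ))) w := by
      refine hexp.mul ?_
      simpa using (hasDerivAt_pow (t + 1) w).div_const ((t + 1).factorial : ℂ)
    refine ((ih.add h1).congr_of_eventuallyEq (Eventually.of_forall fun v => ?_)).congr_deriv ?_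
    · simp only [Pi.add_apply]
      rw [Finset.sum_range_succ, mul_add]
    · rw [Nat.factorial_succ]
      push_cast
      field_simp
      ring

/-- The truncated exponential sums here are what bring the incomplete Gamma terms into the shape of
`bracket_eq`. -/
lemma lowerGamma_succ (t : ℕ) (z : ℂ) :
    lowerGamma (t + 1) z = (t.factorial : ℂ) *
      (1 - Complex.exp (-z) * ∑ q ∈ Finset.range (t + 1), z ^ q / (q.factorial : ℂ)) := by
  have hf : (t.factorial : ℂ) ≠ 0 := by exact_mod_cast t.factorial_ne_zero
  have hd : ∀ u ∈ uIcc (0 : ℝ) 1, HasDerivAt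
      (fun u : ℝ => -(t.factorial : ℂ) * (Complex.exp (-((u : ℂ) * z)) *
        ∑ q ∈ Finset.range (t + 1), ((u : ℂ) * z) ^ q / (q.factorial : ℂ)))
      (z * (((u : ℂ) * z) ^ (t + 1 - 1) * Complex.exp (-((u : ℂ) * z)))) u := by
    intro u _
    have h1 : HasDerivAt (fun u : ℝ => (u : ℂ) * z) z u := by
      simpa using (Complex.ofRealCLM.hasDerivAt (x := u)).mul_const z
    have h2 := ((hasDerivAt_exp_neg_mul_sum t ((u : ℂ) * z)).comp u h1).const_mul
      (-(t.factorial : ℂ))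
    refine h2.congr_deriv ?_
    rw [Nat.add_sub_cancel]
    field_simp
  rw [lowerGamma, intervalIntegral.integral_eq_sub_of_hasDerivAt hd]
  · simp [Finset.sum_range_succ']
    ring
  · exact Continuous.intervalIntegrable (by fun_prop) _ _

lemma lowerGamma_conj {a : ℕ} (ha : 1 ≤ a) (z : ℂ) :
    lowerGamma a (conj z) = conj (lowerGamma a z) := by
  obtain ⟨t, rfl⟩ : ∃ t, a = t + 1 := ⟨a - 1, by omega⟩
  simp [lowerGamma_succ, ← Complex.exp_conj]

lemma integral_pow_mul_exp {a : ℕ} (ha : 1 ≤ a) {β : ℂ} (hβ : β ≠ 0) (x : ℝ) :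
    ∫ u in (0 : ℝ)..x, (u : ℂ) ^ (a - 1) * Complex.exp (-(β * u)) =
      (β ^ a)⁻¹ * lowerGamma a (β * x) := by
  obtain ⟨t, rfl⟩ : ∃ t, a = t + 1 := ⟨a - 1, by omega⟩
  have h := intervalIntegral.smul_integral_comp_mul_right (a := 0) (b := 1)
    (fun u : ℝ => (u : ℂ) ^ t * Complex.exp (-(β * u))) x
  rw [zero_mul, one_mul] at h
  rw [Nat.add_sub_cancel, ← h, lowerGamma, ← intervalIntegral.integral_const_mul,
    ← intervalIntegral.integral_smul]
  congr 1
  funext u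
  have e : (u : ℂ) * (β * x) = β * ((u * x : ℝ) : ℂ) := by push_cast; ring
  rw [Nat.add_sub_cancel, e, Complex.real_smul, mul_pow]
  push_cast
  field_simp
  ring

lemma integral_exp_neg_mul {β : ℂ} (hβ : β ≠ 0) (x : ℝ) :
    ∫ u in (0 : ℝ)..x, Complex.exp (-(β * u)) = (1 - Complex.exp (-(β * x))) / β := by
  have h := integral_pow_mul_exp le_rfl hβ x
  simp only [Nat.sub_self, pow_zero, one_mul, pow_one] at h
  rw [h, show (1 : ℕ) = 0 + 1 from rfl, lowerGamma_succ]
  simp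
  ring

/-! ### The density below `M` -/

/-- The closed form of the bracket multiplying `λ_n c_n` in the density on `[0, M)`. -/
def lowPart (m : ℕ) (l y : ℂ) (x : ℝ) : ℂ :=
  y ^ m * ∑ k ∈ Finset.range m, rootWeight m y k *
    (Complex.exp (-(l * (1 - expEta m k) * x)) - Complex.exp (-(l * (1 - y) * x)))

lemma continuous_lowPart (m : ℕ) (l y : ℂ) : Continuous (lowPart m l y) := by
  unfold lowPart; fun_prop

lemma integral_mul_lowPart (m : ℕ) (l y : ℂ) {w : ℝ → ℂ} (hw : Continuous w) (x : ℝ) :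
    ∫ u in (0 : ℝ)..x, w u * lowPart m l y u =
      y ^ m * ∑ k ∈ Finset.range m, rootWeight m y k *
        ((∫ u in (0 : ℝ)..x, w u * Complex.exp (-(l * (1 - expEta m k) * u))) -
          ∫ u in (0 : ℝ)..x, w u * Complex.exp (-(l * (1 - y) * u))) := by
  have h1 : ∀ u : ℝ, w u * lowPart m l y u = y ^ m * ∑ k ∈ Finset.range m, rootWeight m y k *
      (w u * Complex.exp (-(l * (1 - expEta m k) * u)) -
        w u * Complex.exp (-(l * (1 - y) * u))) := by
    intro u
    rw [lowPart, mul_left_comm, Finset.mul_sum]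
    congr 1
    refine Finset.sum_congr rfl fun k _ => ?_
    ring
  simp only [h1]
  rw [intervalIntegral.integral_const_mul, intervalIntegral.integral_finsetSum]
  · congr 1
    refine Finset.sum_congr rfl fun k _ => ?_
    rw [intervalIntegral.integral_const_mul, intervalIntegral.integral_sub]
    · exact Continuous.intervalIntegrable (by fun_prop) _ _
    · exact Continuous.intervalIntegrable (by fun_prop) _ _
  · intro k _
    exact Continuous.intervalIntegrable (by fun_prop) _ _

section

variable {m : ℕ} (hm : 1 ≤ m) {Xbar M : ℝ} (hX : 0 < Xbar) (hM : Xbar < M)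
include hm hX hM

/-- `bracket_eq` for evaluation at x; the factor exp(-λ x) turns exp(λ x exp(j η_k)) into exp(-θ_k
x). -/
lemma lowBracket_eq (n : ℕ) (x : ℝ) :
    lowBracket m Xbar M n x = lowPart m (rate m Xbar) (ratio m Xbar M n) x := by
  have hl0 := rate_ne_zero hm hX
  set y := ratio m Xbar M n with hy
  have hlam : lam m Xbar M n = rate m Xbar * (1 - y) := lam_eq hX hM n
  have hy1 : ‖y‖ < 1 := norm_ratio_lt_one hX hM n
  have hsub : (rate m Xbar : ℂ) - lam m Xbar M n = rate m Xbar * y := by rw [hlam]; ring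
  have hsc := sum_coeff hm hX hM n
    (fun z => Complex.exp (-(rate m Xbar * (1 - z) * x))) (Complex.exp (-(lam m Xbar M n * x)))
  have hconj : ∀ k, conj (theta m Xbar k) = rate m Xbar * (1 - conj (expEta m k)) := by
    intro k; simp [theta]
  have hre : ∀ t : ℕ, ∑ k ∈ Finset.range m,
      ((((rate m Xbar * expEta m k) ^ t)⁻¹ * Complex.exp (rate m Xbar * x * expEta m k) *
        lowerGamma (t + 1) (rate m Xbar * x * expEta m k)).re : ℂ) =
      ∑ k ∈ Finset.range m,
      ((rate m Xbar * expEta m k) ^ t)⁻¹ * Complex.exp (rate m Xbar * x * expEta m k) *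
        lowerGamma (t + 1) (rate m Xbar * x * expEta m k) := by
    intro t
    refine sum_re_expEta hm (F := fun z => ((rate m Xbar * z) ^ t)⁻¹ *
      Complex.exp (rate m Xbar * x * z) * lowerGamma (t + 1) (rate m Xbar * x * z)) fun z => ?_
    have e : (rate m Xbar * x * conj z : ℂ) = conj (rate m Xbar * x * z : ℂ) := by simp
    simp only [e, lowerGamma_conj (Nat.le_add_left 1 t), Complex.exp_conj]
    simp
  simp only [lowBracket, hre, hsub, theta, map_mul, map_sub, map_one, Complex.conj_ofReal]
  rw [hsc, lowPart, ← hlam, ← bracket_eq hm hy1 hl0 _ (fun k => Complex.exp (-(rate m Xbar *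
    (1 - expEta m k) * x))) (fun t => (x : ℂ) ^ t * Complex.exp (-(rate m Xbar * x)))]
  congr 1
  refine Finset.sum_congr rfl fun t _ => ?_
  rw [mul_assoc]
  congr 1
  rw [mul_add, mul_comm (Complex.exp _)]
  congr 1
  rw [mul_left_comm]
  congr 1
  rw [Finset.mul_sum]
  refine Finset.sum_congr rfl fun k _ => ?_
  have e1 : Complex.exp (-(rate m Xbar * (1 - expEta m k) * x)) =
      Complex.exp (-(rate m Xbar * x)) * Complex.exp (rate m Xbar * x * expEta m k) := by
    rw [← Complex.exp_add]; congr 1; ring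
  have e2 : Complex.exp (rate m Xbar * x * expEta m k) *
      Complex.exp (-(rate m Xbar * x * expEta m k)) = 1 := by
    rw [← Complex.exp_add]; simp
  have e3 : ∑ q ∈ Finset.range (t + 1), (rate m Xbar * expEta m k) ^ q / (q.factorial : ℂ) *
      ((x : ℂ) ^ q * Complex.exp (-(rate m Xbar * x))) = Complex.exp (-(rate m Xbar * x)) *
      ∑ q ∈ Finset.range (t + 1), (rate m Xbar * x * expEta m k) ^ q / (q.factorial : ℂ) := by
    rw [Finset.mul_sum]
    refine Finset.sum_congr rfl fun q _ => ?_
    simp only [mul_pow]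
    ring
  rw [lowerGamma_succ, e1, e3]
  linear_combination -(Complex.exp (-(rate m Xbar * x)) * ((rate m Xbar * expEta m k) ^ t)⁻¹ *
    (t.factorial : ℂ) *
    ∑ q ∈ Finset.range (t + 1), (rate m Xbar * x * expEta m k) ^ q / (q.factorial : ℂ)) * e2

/-! ### Closed forms of D_n and B_{sn} -/

lemma lam_ne_zero (n : ℕ) : lam m Xbar M n ≠ 0 := by
  rw [lam_eq hX hM]
  refine mul_ne_zero (rate_ne_zero hm hX) fun h => ?_
  have h1 := norm_ratio_lt_one (m := m) hX hM n
  rw [← sub_eq_zero.1 h, norm_one] at h1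
  exact lt_irrefl _ h1

-- The case k = 0 becomes a condition on the root itself, so ζ_k is a function of the root that
-- commutes with conjugation.
omit hX hM in
lemma zeta_eq (k : ℕ) (hk : k < m) :
    zeta m Xbar M k = if expEta m k = 1 then (M : ℂ) else
      (1 - Complex.exp (-(rate m Xbar * (1 - expEta m k) * M))) / (rate m Xbar * (1 - expEta m k)) := by
  have h : k = 0 ↔ expEta m k = 1 := by
    refine ⟨fun h => by rw [h, expEta_zero], fun h => ?_⟩
    exact expEta_injOn hm hk (by omega) (h.trans (expEta_zero m).symm)
  simp only [zeta, h, theta]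

omit hM in
lemma zeta_eq_integral (k : ℕ) (hk : k < m) :
    zeta m Xbar M k = ∫ u in (0 : ℝ)..M, Complex.exp (-(rate m Xbar * (1 - expEta m k) * u)) := by
  rw [zeta_eq hm k hk]
  split_ifs with h
  · simp [h]
  · rw [integral_exp_neg_mul (mul_ne_zero (rate_ne_zero hm hX) (sub_ne_zero.2 (Ne.symm h)))]

/-- `bracket_eq` for integration over [0, M]. The right side is the mass of the n-th component: the
last term is the integral of λ_n exp(-λ_n x) beyond M. -/
lemma coeffD_eq (n : ℕ) :
    coeffD m Xbar M n = lam m Xbar M n *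
      (∫ u in (0 : ℝ)..M, lowPart m (rate m Xbar) (ratio m Xbar M n) u) +
      Complex.exp (-(lam m Xbar M n * M)) := by
  have hl0 := rate_ne_zero hm hX
  have hln := lam_ne_zero hm hX hM n
  set y := ratio m Xbar M n with hy
  have hlam : lam m Xbar M n = rate m Xbar * (1 - y) := lam_eq hX hM n
  have hy1 : ‖y‖ < 1 := norm_ratio_lt_one hX hM n
  have hsub : (rate m Xbar : ℂ) - lam m Xbar M n = rate m Xbar * y := by rw [hlam]; ring
  set F : ℂ → ℂ := fun z => if z = 1 then (M : ℂ) else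
      (1 - Complex.exp (-(rate m Xbar * (1 - z) * M))) / (rate m Xbar * (1 - z)) with hF
  have hFconj : ∀ z, F (conj z) = conj (F z) := by
    intro z
    have h1 : conj z = 1 ↔ z = 1 := by rw [← map_one conj, (starRingEnd ℂ).injective.eq_iff]; simp
    simp only [hF, h1]
    split_ifs with h
    · simp
    · simp [← Complex.exp_conj]
  set P : ℂ := (1 - Complex.exp (-(lam m Xbar M n * M))) / lam m Xbar M n with hP
  set T : ℕ → ℂ := fun t => (rate m Xbar ^ (t + 1) : ℂ)⁻¹ * lowerGamma (t + 1) (rate m Xbar * M)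
    with hT
  have hTconj : ∀ t, conj (T t) = T t := by
    intro t
    simp only [hT, map_mul, map_inv₀, map_pow, Complex.conj_ofReal,
      ← lowerGamma_conj (Nat.le_add_left 1 t)]
  have hint : ∫ u in (0 : ℝ)..M, lowPart m (rate m Xbar) y u =
      y ^ m * ∑ k ∈ Finset.range m, rootWeight m y k * (F (expEta m k) - P) := by
    have h := integral_mul_lowPart m (rate m Xbar) y (w := fun _ => 1) continuous_const M
    simp only [one_mul] at h
    rw [h]
    congr 1
    refine Finset.sum_congr rfl fun k hk => ?_
    rw [← zeta_eq_integral hm hX k (Finset.mem_range.1 hk), ← hlam, integral_exp_neg_mul hln,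
      zeta_eq hm k (Finset.mem_range.1 hk)]
  have hsum : (rate m Xbar : ℂ) / m * ∑ k ∈ Finset.range m,
      (coeffA m Xbar M n k * zeta m Xbar M k + coeffB m Xbar M n k * conj (zeta m Xbar M k)
        - (coeffA m Xbar M n k + coeffB m Xbar M n k) / lam m Xbar M n *
          (1 - Complex.exp (-(lam m Xbar M n * M)))) =
      ∑ k ∈ Finset.range m, rootWeight m y k * (F (expEta m k) - P) := by
    rw [← sum_coeff hm hX hM n F P]
    congr 1
    refine Finset.sum_congr rfl fun k hk => ?_
    rw [zeta_eq hm k (Finset.mem_range.1 hk), hFconj]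
    simp only [hP]
    ring
  have hre : ∀ t : ℕ, ∑ k ∈ Finset.range m,
      ((((rate m Xbar * expEta m k) ^ t)⁻¹ * (zeta m Xbar M k - ∑ q ∈ Finset.range (t + 1),
        expEta m k ^ q * (rate m Xbar : ℂ)⁻¹ / (q.factorial : ℂ) *
          lowerGamma (q + 1) (rate m Xbar * M))).re : ℂ) =
      ∑ k ∈ Finset.range m, ((rate m Xbar * expEta m k) ^ t)⁻¹ * (F (expEta m k) -
        ∑ q ∈ Finset.range (t + 1), (rate m Xbar * expEta m k) ^ q / (q.factorial : ℂ) * T q) := by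
    intro t
    rw [← sum_re_expEta hm (F := fun z => ((rate m Xbar * z) ^ t)⁻¹ * (F z -
        ∑ q ∈ Finset.range (t + 1), (rate m Xbar * z) ^ q / (q.factorial : ℂ) * T q))]
    · refine Finset.sum_congr rfl fun k hk => ?_
      rw [zeta_eq hm k (Finset.mem_range.1 hk)]
      congr 4
      refine Finset.sum_congr rfl fun q _ => ?_
      simp only [hT, mul_pow, pow_succ]
      field_simp
    · intro z
      simp only [hFconj, map_mul, map_inv₀, map_pow, Complex.conj_ofReal, map_sub, map_sum,
        map_div₀, map_natCast, hTconj]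
  have hbr := bracket_eq hm hy1 hl0 P (fun k => F (expEta m k)) T
  simp only [coeffD, hre, hsub]
  rw [mul_div_assoc, mul_assoc, hsum, hint, ← hbr]
  have hterm : ∀ t ∈ Finset.range m, (rate m Xbar * y) ^ t *
      ((rate m Xbar ^ (t + 1) : ℂ)⁻¹ / (t.factorial : ℂ) * lowerGamma (t + 1) (rate m Xbar * M) +
        1 / m * ∑ k ∈ Finset.range m, ((rate m Xbar * expEta m k) ^ t)⁻¹ * (F (expEta m k) -
        ∑ q ∈ Finset.range (t + 1), (rate m Xbar * expEta m k) ^ q / (q.factorial : ℂ) * T q)) =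
      (rate m Xbar * y) ^ t / (t.factorial : ℂ) *
        (T t + 1 / m * ∑ k ∈ Finset.range m, ((rate m Xbar * expEta m k) ^ t)⁻¹ *
          (t.factorial : ℂ) * (F (expEta m k) -
        ∑ q ∈ Finset.range (t + 1), (rate m Xbar * expEta m k) ^ q / (q.factorial : ℂ) * T q)) := by
    intro t _
    have hf : (t.factorial : ℂ) ≠ 0 := by exact_mod_cast t.factorial_ne_zero
    have h1 : ∀ k, ((rate m Xbar * expEta m k) ^ t)⁻¹ *
          (t.factorial : ℂ) * (F (expEta m k) - ∑ q ∈ Finset.range (t + 1),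
            (rate m Xbar * expEta m k) ^ q / (q.factorial : ℂ) * T q) =
        (t.factorial : ℂ) * (((rate m Xbar * expEta m k) ^ t)⁻¹ * (F (expEta m k) -
          ∑ q ∈ Finset.range (t + 1), (rate m Xbar * expEta m k) ^ q / (q.factorial : ℂ) * T q)) :=
      fun k => by ring
    simp only [h1, ← Finset.mul_sum]
    simp only [hT]
    field_simp
  rw [Finset.sum_congr rfl hterm]
  -- The summand 1 of D_n splits into the leading `P` of the bracket, times λ_n, and the mass beyond
  -- M.
  have hPl : lam m Xbar M n * P = 1 - Complex.exp (-(lam m Xbar M n * M)) := by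
    simp only [hP]; field_simp
  linear_combination -hPl

omit hm hX hM in
/-- The integral `I_s(β)` in terms of the exponent `β + λ`. -/
lemma integralI_eq {s : ℕ} (hs : s < m) {β : ℂ} (hβ : β ≠ 0) :
    integralI m M s β = ∫ u in (0 : ℝ)..M, (u : ℂ) ^ (m - 1 - s) * Complex.exp (-(β * u)) := by
  have h := integral_pow_mul_exp (a := m - s) (by omega) hβ M
  rw [integralI, ← h, show m - s - 1 = m - 1 - s by omega]

/-- `bracket_eq` for integration over [0, M] against u^(m-1-s) exp(λ u), the weight from the
binomial expansion of the Gamma kernel. All arguments of I_s are nonzero because y ≠ 0. -/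
lemma coeffBsn_eq {s : ℕ} (hs : s < m) (n : ℕ) :
    coeffBsn m Xbar M s n = lam m Xbar M n / (rate m Xbar : ℂ) ^ (s + 1) *
      ((rate m Xbar : ℂ) ^ m * (-1) ^ (m - 1 - s) / ((m - 1 - s).factorial : ℂ) *
        (∫ u in (0 : ℝ)..M, (u : ℂ) ^ (m - 1 - s) * Complex.exp (rate m Xbar * u) *
          lowPart m (rate m Xbar) (ratio m Xbar M n) u) -
        (rate m Xbar * ratio m Xbar M n) ^ s) := by
  have hl0 := rate_ne_zero hm hX
  set y := ratio m Xbar M n with hy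
  have hy0 : y ≠ 0 := ratio_ne_zero hX hM n
  have hlam : lam m Xbar M n = rate m Xbar * (1 - y) := lam_eq hX hM n
  have hy1 : ‖y‖ < 1 := norm_ratio_lt_one hX hM n
  have hsub : (rate m Xbar : ℂ) - lam m Xbar M n = rate m Xbar * y := by rw [hlam]; ring
  have hsub' : lam m Xbar M n - (rate m Xbar : ℂ) = -(rate m Xbar * y) := by rw [hlam]; ring
  set F : ℂ → ℂ := fun z => integralI m M s (rate m Xbar * (1 - z) - rate m Xbar) with hF
  have hms : 1 ≤ m - s := by omega
  have hFconj : ∀ z, F (conj z) = conj (F z) := by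
    intro z
    simp only [hF, integralI, map_mul, map_inv₀, map_pow, ← lowerGamma_conj hms, map_sub, map_one,
      Complex.conj_ofReal]
  have hFneg : ∀ z, F z = integralI m M s (-(rate m Xbar * z)) := fun z => by
    simp only [hF]; congr 1; ring
  set P : ℂ := integralI m M s (lam m Xbar M n - rate m Xbar) with hP
  set T : ℕ → ℂ := fun t => (M : ℂ) ^ (m + t - s) / ((m + t - s : ℕ) : ℂ) with hT
  have hTconj : ∀ t, conj (T t) = T t := by
    intro t
    simp only [hT, map_div₀, map_pow, Complex.conj_ofReal, map_natCast]
  have hint : ∫ u in (0 : ℝ)..M, (u : ℂ) ^ (m - 1 - s) * Complex.exp (rate m Xbar * u) *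
          lowPart m (rate m Xbar) y u =
      y ^ m * ∑ k ∈ Finset.range m, rootWeight m y k * (F (expEta m k) - P) := by
    rw [integral_mul_lowPart m (rate m Xbar) y
      (w := fun u => (u : ℂ) ^ (m - 1 - s) * Complex.exp (rate m Xbar * u)) (by fun_prop) M]
    congr 1
    have e : ∀ z : ℂ, z ≠ 0 → ∫ u in (0 : ℝ)..M, (u : ℂ) ^ (m - 1 - s) *
        Complex.exp (rate m Xbar * u) * Complex.exp (-(rate m Xbar * (1 - z) * u)) =
        integralI m M s (-(rate m Xbar * z)) := by
      intro z hz
      rw [integralI_eq hs (neg_ne_zero.2 (mul_ne_zero hl0 hz))]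
      congr 1
      funext u
      rw [mul_assoc, ← Complex.exp_add]
      congr 2
      ring
    refine Finset.sum_congr rfl fun k hk => ?_
    rw [e _ (expEta_ne_zero m k), e _ hy0, hP, hsub', hFneg]
  have hsum : (rate m Xbar : ℂ) / m * ∑ k ∈ Finset.range m,
      (coeffA m Xbar M n k * integralI m M s (theta m Xbar k - rate m Xbar) +
        coeffB m Xbar M n k * integralI m M s (conj (theta m Xbar k) - rate m Xbar)
        - (coeffA m Xbar M n k + coeffB m Xbar M n k) * P) =
      ∑ k ∈ Finset.range m, rootWeight m y k * (F (expEta m k) - P) := by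
    rw [← sum_coeff hm hX hM n F P]
    simp only [hF, theta, map_mul, map_sub, map_one, Complex.conj_ofReal]
  have hre : ∀ t : ℕ, ∑ k ∈ Finset.range m,
      ((((rate m Xbar * expEta m k) ^ t)⁻¹ * (t.factorial : ℂ) *
        (integralI m M s (-(rate m Xbar * expEta m k)) - ∑ q ∈ Finset.range (t + 1),
        (rate m Xbar * expEta m k) ^ q / (q.factorial : ℂ) *
          ((M : ℂ) ^ (m + q - s) / ((m + q - s : ℕ) : ℂ)))).re : ℂ) =
      ∑ k ∈ Finset.range m, ((rate m Xbar * expEta m k) ^ t)⁻¹ * (t.factorial : ℂ) *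
        (F (expEta m k) -
        ∑ q ∈ Finset.range (t + 1), (rate m Xbar * expEta m k) ^ q / (q.factorial : ℂ) * T q) := by
    intro t
    rw [← sum_re_expEta hm (F := fun z => ((rate m Xbar * z) ^ t)⁻¹ * (t.factorial : ℂ) * (F z -
        ∑ q ∈ Finset.range (t + 1), (rate m Xbar * z) ^ q / (q.factorial : ℂ) * T q))]
    · refine Finset.sum_congr rfl fun k hk => ?_
      rw [hFneg]
    · intro z
      simp only [hFconj, map_mul, map_inv₀, map_pow, Complex.conj_ofReal, map_sub, map_sum,
        map_div₀, map_natCast, hTconj]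
  have hbr := bracket_eq hm hy1 hl0 P (fun k => F (expEta m k)) T
  simp only [coeffBsn, hre, hsub]
  rw [hsum, hint, ← hbr]
  have hf : ((m - 1 - s).factorial : ℂ) ≠ 0 := by exact_mod_cast (m - 1 - s).factorial_ne_zero
  simp only [hT]
  field_simp
  ring

end

/-! ### The integral equation for the density -/

/-- The Gamma density with shape `m` and rate `l`, without the restriction to `[0, ∞)`. -/
def gammaKernel (m : ℕ) (l : ℝ) (z : ℝ) : ℂ :=
  (l : ℂ) ^ m / ((m - 1).factorial : ℂ) * (z : ℂ) ^ (m - 1) * Complex.exp (-(l * z))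

lemma continuous_gammaKernel (m : ℕ) (l : ℝ) : Continuous (gammaKernel m l) := by
  unfold gammaKernel; fun_prop

lemma gammaPDFReal_eq_gammaKernel {m : ℕ} (hm : 1 ≤ m) (l : ℝ) {z : ℝ} (hz : 0 ≤ z) :
    ((gammaPDFReal m l z : ℝ) : ℂ) = gammaKernel m l z := by
  obtain ⟨t, rfl⟩ : ∃ t, m = t + 1 := ⟨m - 1, by omega⟩
  have h1 : ((t + 1 : ℕ) : ℝ) - 1 = (t : ℕ) := by push_cast; ring
  rw [gammaPDFReal, if_pos hz, gammaKernel, h1, Real.rpow_natCast, Real.rpow_natCast,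
    Nat.add_sub_cancel, Nat.cast_succ, Real.Gamma_nat_eq_factorial]
  push_cast
  rfl

/-- Substituting v = x - u leaves exp(-μ x) times an incomplete Gamma integral in α. -/
lemma integral_gammaKernel_exp {m : ℕ} (hm : 1 ≤ m) (l : ℝ) {α μ : ℂ} (hα : α ≠ 0)
    (hμ : μ = l - α) (x : ℝ) :
    ∫ u in (0 : ℝ)..x, gammaKernel m l (x - u) * Complex.exp (-(μ * u)) =
      (l / α) ^ m * (Complex.exp (-(μ * x)) - Complex.exp (-(l * x)) *
        ∑ q ∈ Finset.range m, (α * x) ^ q / (q.factorial : ℂ)) := by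
  obtain ⟨t, rfl⟩ : ∃ t, m = t + 1 := ⟨m - 1, by omega⟩
  have hf : (t.factorial : ℂ) ≠ 0 := by exact_mod_cast t.factorial_ne_zero
  have h1 := intervalIntegral.integral_comp_sub_left (a := 0) (b := x)
    (fun v : ℝ => gammaKernel (t + 1) l v * Complex.exp (-(μ * ((x - v : ℝ) : ℂ)))) x
  simp only [sub_sub_cancel, sub_self, sub_zero] at h1
  rw [h1]
  have h2 : ∀ v : ℝ, gammaKernel (t + 1) l v * Complex.exp (-(μ * ((x - v : ℝ) : ℂ))) =
      (l : ℂ) ^ (t + 1) / (t.factorial : ℂ) * Complex.exp (-(μ * x)) *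
        ((v : ℂ) ^ (t + 1 - 1) * Complex.exp (-(α * v))) := by
    intro v
    have e : Complex.exp (-(l * v)) * Complex.exp (-(μ * ((x - v : ℝ) : ℂ))) =
        Complex.exp (-(μ * x)) * Complex.exp (-(α * v)) := by
      rw [← Complex.exp_add, ← Complex.exp_add, hμ]
      congr 1
      push_cast
      ring
    simp only [gammaKernel, Nat.add_sub_cancel]
    linear_combination (l : ℂ) ^ (t + 1) / (t.factorial : ℂ) * (v : ℂ) ^ t * e
  simp only [h2]
  rw [intervalIntegral.integral_const_mul, integral_pow_mul_exp hm hα, lowerGamma_succ]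
  have e2 : Complex.exp (-(l * x)) = Complex.exp (-(μ * x)) * Complex.exp (-(α * x)) := by
    rw [← Complex.exp_add, hμ]
    congr 1
    ring
  rw [e2, div_pow]
  field_simp

section

variable {m : ℕ} (hm : 1 ≤ m) {l : ℝ} (hl : 0 < l) {y : ℂ} (hy : ‖y‖ < 1) (hy0 : y ≠ 0)
include hm hl hy hy0

/-- The terms in θ_k reproduce themselves up to Taylor polynomials in the roots, which the weights
turn into the one at y; for λ_n the prefactor y^m cancels y^(-m). The defect is exactly what
`integral_gammaKernel_shift` supplies. -/
lemma integral_gammaKernel_lowPart (x : ℝ) :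
    ∫ u in (0 : ℝ)..x, gammaKernel m l (x - u) * lowPart m l y u =
      lowPart m l y x - (Complex.exp (-(l * (1 - y) * x)) - Complex.exp (-(l * x)) *
        ∑ q ∈ Finset.range m, (l * y * x) ^ q / (q.factorial : ℂ)) := by
  have hl0 : (l : ℂ) ≠ 0 := by exact_mod_cast hl.ne'
  have hk := continuous_gammaKernel m l
  rw [integral_mul_lowPart m l y (w := fun u => gammaKernel m l (x - u)) (by fun_prop) x]
  have h1 : ∀ k, ∫ u in (0 : ℝ)..x, gammaKernel m l (x - u) *
      Complex.exp (-(l * (1 - expEta m k) * u)) = Complex.exp (-(l * (1 - expEta m k) * x)) -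
        Complex.exp (-(l * x)) * ∑ q ∈ Finset.range m, (l * expEta m k * x) ^ q / (q.factorial : ℂ) := by
    intro k
    have he := expEta_ne_zero m k
    rw [integral_gammaKernel_exp hm l (mul_ne_zero hl0 he) (by ring) x, div_pow, mul_pow,
      expEta_pow_self hm, mul_one, div_self (pow_ne_zero _ hl0), one_mul]
  have h2 : y ^ m * ∫ u in (0 : ℝ)..x, gammaKernel m l (x - u) *
      Complex.exp (-(l * (1 - y) * u)) = Complex.exp (-(l * (1 - y) * x)) -
        Complex.exp (-(l * x)) * ∑ q ∈ Finset.range m, (l * y * x) ^ q / (q.factorial : ℂ) := by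
    rw [integral_gammaKernel_exp hm l (mul_ne_zero hl0 hy0) (by ring) x, div_pow, mul_pow]
    have := pow_ne_zero m hl0
    have := pow_ne_zero m hy0
    field_simp
  have h3 : (1 - y ^ m) * ∑ k ∈ Finset.range m, rootWeight m y k *
      ∑ q ∈ Finset.range m, (l * expEta m k * x) ^ q / (q.factorial : ℂ) =
      ∑ q ∈ Finset.range m, (l * y * x) ^ q / (q.factorial : ℂ) := by
    simp only [Finset.mul_sum]
    rw [Finset.sum_comm]
    refine Finset.sum_congr rfl fun q hq => ?_
    calc _ = (l * x) ^ q / (q.factorial : ℂ) *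
          ((1 - y ^ m) * ∑ k ∈ Finset.range m, rootWeight m y k * expEta m k ^ q) := by
          simp only [Finset.mul_sum]
          refine Finset.sum_congr rfl fun k _ => ?_
          simp only [mul_pow]
          ring
      _ = _ := by
          rw [sum_rootWeight_mul_pow hm hy (Finset.mem_range.1 hq)]
          simp only [mul_pow]
          ring
  have h4 := sum_rootWeight hm hy
  have h5 := one_sub_pow_ne_zero hm hy
  have hsplit : ∀ (a : ℕ → ℂ) (c : ℂ), ∑ k ∈ Finset.range m, rootWeight m y k * (a k - c) =
      ∑ k ∈ Finset.range m, rootWeight m y k * a k - (∑ k ∈ Finset.range m, rootWeight m y k) * c := by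
    intro a c
    simp only [mul_sub, Finset.sum_sub_distrib, Finset.sum_mul]
  have h6 : ∑ k ∈ Finset.range m, rootWeight m y k *
      (Complex.exp (-(l * (1 - expEta m k) * x)) - Complex.exp (-(l * x)) *
        ∑ q ∈ Finset.range m, (l * expEta m k * x) ^ q / (q.factorial : ℂ)) =
      ∑ k ∈ Finset.range m, rootWeight m y k * Complex.exp (-(l * (1 - expEta m k) * x)) -
      Complex.exp (-(l * x)) * ∑ k ∈ Finset.range m, rootWeight m y k *
        ∑ q ∈ Finset.range m, (l * expEta m k * x) ^ q / (q.factorial : ℂ) := by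
    rw [Finset.mul_sum, ← Finset.sum_sub_distrib]
    exact Finset.sum_congr rfl fun k _ => by ring
  simp only [h1, lowPart]
  rw [hsplit, hsplit, mul_sub, mul_left_comm (y ^ m) (∑ k ∈ Finset.range m, rootWeight m y k), h2, h6]
  refine mul_left_cancel₀ h5 ?_
  set E := Complex.exp (-((l : ℂ) * x))
  set Ey := Complex.exp (-(l * (1 - y) * x))
  set R := ∑ k ∈ Finset.range m, rootWeight m y k
  set S := ∑ q ∈ Finset.range m, (l * y * x) ^ q / (q.factorial : ℂ)
  linear_combination (-y ^ m * E) * h3 + ((y ^ m - 1) * Ey + E * S) * h4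

-- The shift by M contributes exp(-λ_n M) = y^m, which cancels the factor y^(-m) of the convolution.
omit hy in
lemma integral_gammaKernel_shift {M : ℝ} (hyM : y ^ m = Complex.exp (-(l * (1 - y) * M))) (x : ℝ) :
    ∫ v in (0 : ℝ)..x, gammaKernel m l (x - v) *
        Complex.exp (-(l * (1 - y) * ((v + M : ℝ) : ℂ))) =
      Complex.exp (-(l * (1 - y) * x)) - Complex.exp (-(l * x)) *
        ∑ q ∈ Finset.range m, (l * y * x) ^ q / (q.factorial : ℂ) := by
  have hl0 : (l : ℂ) ≠ 0 := by exact_mod_cast hl.ne'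
  have h1 : ∀ v : ℝ, gammaKernel m l (x - v) * Complex.exp (-(l * (1 - y) * ((v + M : ℝ) : ℂ))) =
      y ^ m * (gammaKernel m l (x - v) * Complex.exp (-(l * (1 - y) * v))) := by
    intro v
    have e : Complex.exp (-(l * (1 - y) * ((v + M : ℝ) : ℂ))) =
        Complex.exp (-(l * (1 - y) * M)) * Complex.exp (-(l * (1 - y) * v)) := by
      rw [← Complex.exp_add]
      congr 1
      push_cast
      ring
    rw [e, hyM]
    ring
  simp only [h1]
  rw [intervalIntegral.integral_const_mul,
    integral_gammaKernel_exp hm l (mul_ne_zero hl0 hy0) (by ring) x, div_pow, mul_pow]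
  have := pow_ne_zero m hl0
  have := pow_ne_zero m hy0
  field_simp

-- The binomial theorem separates the variables, which is why only m functions of x can appear as
-- discrepancy above M.
omit hl hy hy0 in
lemma gammaKernel_sub (x u : ℝ) : gammaKernel m l (x - u) =
    ∑ s ∈ Finset.range m, (x : ℂ) ^ s / (s.factorial : ℂ) * Complex.exp (-(l * x)) *
      ((l : ℂ) ^ m * (-1) ^ (m - 1 - s) / ((m - 1 - s).factorial : ℂ)) *
        ((u : ℂ) ^ (m - 1 - s) * Complex.exp (l * u)) := by
  obtain ⟨t, rfl⟩ : ∃ t, m = t + 1 := ⟨m - 1, by omega⟩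
  have e : Complex.exp (-(l * ((x - u : ℝ) : ℂ))) =
      Complex.exp (-(l * x)) * Complex.exp (l * u) := by
    rw [← Complex.exp_add]
    congr 1
    push_cast
    ring
  rw [gammaKernel, e]
  push_cast
  rw [sub_eq_add_neg (x : ℂ), add_pow, Finset.mul_sum, Finset.sum_mul]
  refine Finset.sum_congr rfl fun s hs => ?_
  have hst : s ≤ t := by rw [Finset.mem_range] at hs; omega
  rw [Nat.cast_choose ℂ hst, neg_pow (u : ℂ)]
  have hf : ∀ q : ℕ, (q.factorial : ℂ) ≠ 0 := fun q => by exact_mod_cast q.factorial_ne_zero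
  have := hf t
  have := hf s
  have := hf (t - s)
  field_simp

omit hl hy hy0 in
lemma integral_gammaKernel_sub_mul {w : ℝ → ℂ} (hw : Continuous w) (x M : ℝ) :
    ∫ u in (0 : ℝ)..M, gammaKernel m l (x - u) * w u =
    ∑ s ∈ Finset.range m, (x : ℂ) ^ s / (s.factorial : ℂ) * Complex.exp (-(l * x)) *
      ((l : ℂ) ^ m * (-1) ^ (m - 1 - s) / ((m - 1 - s).factorial : ℂ) *
        ∫ u in (0 : ℝ)..M, (u : ℂ) ^ (m - 1 - s) * Complex.exp (l * u) * w u) := by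
  simp only [gammaKernel_sub hm, Finset.sum_mul]
  rw [intervalIntegral.integral_finsetSum]
  · refine Finset.sum_congr rfl fun s _ => ?_
    rw [← mul_assoc, ← intervalIntegral.integral_const_mul]
    congr 1
    funext u
    ring
  · exact fun s _ => Continuous.intervalIntegrable (by fun_prop) _ _

end

/-- The action of the transition density on a function given by two continuous pieces. -/
lemma integral_stepDensity_mul {m : ℕ} (hm : 1 ≤ m) {l M : ℝ} (hM : 0 < M) {lo hi : ℝ → ℂ}
    (hlo : Continuous lo) (hhi : Continuous hi) {y : ℝ} (hy : 0 < y) :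
    ∫ x, (stepDensity m l M x y : ℂ) * (if x < M then lo x else hi x) ∂volIci =
      (∫ u in (0 : ℝ)..(min y M), gammaKernel m l (y - u) * lo u) +
        ∫ v in (0 : ℝ)..y, gammaKernel m l (y - v) * hi (v + M) := by
  have hk := continuous_gammaKernel m l
  have hmin : 0 ≤ min y M := (lt_min hy hM).le
  have h2 := intervalIntegral.integral_comp_add_right (a := 0) (b := y)
    (fun x : ℝ => gammaKernel m l (y - (x - M)) * hi x) M
  simp only [add_sub_cancel_right, zero_add] at h2
  rw [h2, intervalIntegral.integral_of_le hmin, intervalIntegral.integral_of_le (by linarith),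
    ← integral_indicator measurableSet_Ici, ← integral_indicator measurableSet_Ioc,
    ← integral_indicator measurableSet_Ioc, ← integral_add]
  · refine integral_congr_ae ?_
    -- Off the endpoints 0 and M the half-open intervals and the strict threshold of the policy
    -- agree.
    have hne : ∀ a : ℝ, ∀ᵐ x : ℝ, x ≠ a := fun a => by simp [ae_iff]
    filter_upwards [hne 0, hne M] with x hx0 hxM
    rcases lt_or_gt_of_ne hx0 with h0 | h0
    · rw [indicator_of_notMem (by simpa using h0), indicator_of_notMem, indicator_of_notMem, add_zero]
      · simp only [mem_Ioc, not_and_or, not_lt]; left; linarith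
      · simp only [mem_Ioc, not_and_or, not_lt]; left; linarith
    rw [indicator_of_mem (show x ∈ Ici (0 : ℝ) from h0.le)]
    rcases lt_or_gt_of_ne hxM with h1 | h1
    · have hT : stepDensity m l M x y = gammaPDFReal m l (y - x) := by
        rw [stepDensity, afterTransmit_of_le h1.le]
      rw [if_pos h1, hT, indicator_of_notMem (s := Ioc M (y + M)), add_zero]
      · by_cases h : x ≤ y
        · rw [indicator_of_mem (show x ∈ Ioc 0 (min y M) from ⟨h0, le_min h h1.le⟩), gammaPDFReal_eq_gammaKernel hm l (by linarith)]
        · rw [indicator_of_notMem fun h' => h (h'.2.trans (min_le_left _ _)), gammaPDFReal,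
            if_neg (by linarith)]
          simp
      · simp only [mem_Ioc, not_and_or, not_lt]; left; linarith
    · have hT : stepDensity m l M x y = gammaPDFReal m l (y - (x - M)) := by
        rw [stepDensity, afterTransmit_of_lt h1]
      rw [if_neg h1.not_gt, hT, indicator_of_notMem (s := Ioc 0 (min y M)), zero_add]
      · by_cases h : x ≤ y + M
        · rw [indicator_of_mem (show x ∈ Ioc M (y + M) from ⟨h1, h⟩), gammaPDFReal_eq_gammaKernel hm l (by linarith)]
        · rw [indicator_of_notMem fun h' => h h'.2, gammaPDFReal, if_neg (by linarith)]
          simp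
      · exact fun h' => absurd (h'.2.trans (min_le_right _ _)) (not_le.2 h1)
  · rw [integrable_indicator_iff measurableSet_Ioc]
    exact (Continuous.integrableOn_Icc (by fun_prop)).mono_set Ioc_subset_Icc_self
  · rw [integrable_indicator_iff measurableSet_Ioc]
    exact (Continuous.integrableOn_Icc (by fun_prop)).mono_set Ioc_subset_Icc_self

/-! ### The candidate density -/

/-- The claimed form of the limiting density on `[0, M)`. -/
def candidateLow (m : ℕ) (Xbar M : ℝ) (c : Fin m → ℂ) (x : ℝ) : ℂ :=
  ∑ n : Fin m, lam m Xbar M n * c n * lowPart m (rate m Xbar) (ratio m Xbar M n) x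

/-- The claimed form of the limiting density on `[M, ∞)`. -/
def candidateHigh (m : ℕ) (Xbar M : ℝ) (c : Fin m → ℂ) (x : ℝ) : ℂ :=
  ∑ n : Fin m, lam m Xbar M n * c n * Complex.exp (-(lam m Xbar M n * x))

/-- The claimed form of the limiting density. -/
def candidate (m : ℕ) (Xbar M : ℝ) (c : Fin m → ℂ) (x : ℝ) : ℂ :=
  if x < M then candidateLow m Xbar M c x else candidateHigh m Xbar M c x

lemma candidate_of_lt {m : ℕ} {Xbar M : ℝ} {c : Fin m → ℂ} {x : ℝ} (hx : x < M) :
    candidate m Xbar M c x = candidateLow m Xbar M c x := if_pos hx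

lemma candidate_of_le {m : ℕ} {Xbar M : ℝ} {c : Fin m → ℂ} {x : ℝ} (hx : M ≤ x) :
    candidate m Xbar M c x = candidateHigh m Xbar M c x := if_neg (not_lt.2 hx)

/-- The functions spanning the discrepancy in the integral equation above `M`. -/
def tailTerm (m : ℕ) (Xbar : ℝ) (s : ℕ) (x : ℝ) : ℝ :=
  rate m Xbar ^ (s + 1) * (x ^ s / s.factorial * Real.exp (-(rate m Xbar * x)))

lemma continuous_candidateLow (m : ℕ) (Xbar M : ℝ) (c : Fin m → ℂ) :
    Continuous (candidateLow m Xbar M c) :=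
  continuous_finsetSum _ fun _ _ => continuous_const.mul (continuous_lowPart _ _ _)

lemma continuous_candidateHigh (m : ℕ) (Xbar M : ℝ) (c : Fin m → ℂ) :
    Continuous (candidateHigh m Xbar M c) := by
  unfold candidateHigh; fun_prop

lemma measurable_candidate (m : ℕ) (Xbar M : ℝ) (c : Fin m → ℂ) :
    Measurable (candidate m Xbar M c) :=
  Measurable.ite measurableSet_Iio (continuous_candidateLow _ _ _ _).measurable
    (continuous_candidateHigh _ _ _ _).measurable

lemma integral_mul_sum {ι : Type*} (t : Finset ι) {k : ℝ → ℂ} (hk : Continuous k) (a : ι → ℂ)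
    {w : ι → ℝ → ℂ} (hw : ∀ n ∈ t, Continuous (w n)) (p q : ℝ) :
    ∫ u in p..q, k u * ∑ n ∈ t, a n * w n u = ∑ n ∈ t, a n * ∫ u in p..q, k u * w n u := by
  simp only [Finset.mul_sum]
  rw [intervalIntegral.integral_finsetSum]
  · refine Finset.sum_congr rfl fun n _ => ?_
    rw [← intervalIntegral.integral_const_mul]
    congr 1
    funext u
    ring
  · intro n hn
    have := hw n hn
    exact Continuous.intervalIntegrable (by fun_prop) _ _

section

variable {m : ℕ} (hm : 1 ≤ m) {Xbar M : ℝ} (hX : 0 < Xbar) (hM : Xbar < M) (c : Fin m → ℂ)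
include hm hX hM

lemma lam_re_pos (n : ℕ) : 0 < (lam m Xbar M n).re := by
  rw [lam_eq hX hM, Complex.re_ofReal_mul]
  refine mul_pos (rate_pos hm hX) ?_
  have h1 := (Complex.re_le_norm (ratio m Xbar M n)).trans_lt (norm_ratio_lt_one hX hM n)
  simp only [Complex.sub_re, Complex.one_re]
  linarith

lemma lam_injective : Function.Injective fun n : Fin m => lam m Xbar M n := by
  intro n n' h
  simp only [lam_eq hX hM] at h
  have h1 := mul_left_cancel₀ (rate_ne_zero hm hX) h
  exact Fin.ext (ratio_injOn hm hX hM n.2 n'.2 (by linear_combination -h1))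

/-- One step of the process maps the candidate to itself, up to a discrepancy above `M` which is
measured by the coefficients `B_{sn}`. -/
lemma integral_stepDensity_candidate {y : ℝ} (hy : 0 < y) :
    ∫ x, (stepDensity m (rate m Xbar) M x y : ℂ) * candidate m Xbar M c x ∂volIci =
      candidate m Xbar M c y + if M ≤ y then
        ∑ s ∈ Finset.range m, (tailTerm m Xbar s y : ℂ) * ∑ n : Fin m, coeffBsn m Xbar M s n * c n
      else 0 := by
  have hM0 := hX.trans hM
  have hl := rate_pos hm hX
  have hl0 := rate_ne_zero hm hX
  have hk := continuous_gammaKernel m (rate m Xbar)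
  have hlow : ∀ n, ∀ x : ℝ, ∫ u in (0 : ℝ)..x, gammaKernel m (rate m Xbar) (x - u) *
      lowPart m (rate m Xbar) (ratio m Xbar M n) u =
      lowPart m (rate m Xbar) (ratio m Xbar M n) x - (Complex.exp (-(lam m Xbar M n * x)) -
        Complex.exp (-(rate m Xbar * x)) *
        ∑ q ∈ Finset.range m, (rate m Xbar * ratio m Xbar M n * x) ^ q / (q.factorial : ℂ)) := by
    intro n x
    rw [lam_eq hX hM]
    exact integral_gammaKernel_lowPart hm hl (norm_ratio_lt_one hX hM n) (ratio_ne_zero hX hM n) x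
  have hhigh : ∀ n, ∀ x : ℝ, ∫ v in (0 : ℝ)..x, gammaKernel m (rate m Xbar) (x - v) *
      Complex.exp (-(lam m Xbar M n * ((v + M : ℝ) : ℂ))) =
      Complex.exp (-(lam m Xbar M n * x)) - Complex.exp (-(rate m Xbar * x)) *
        ∑ q ∈ Finset.range m, (rate m Xbar * ratio m Xbar M n * x) ^ q / (q.factorial : ℂ) := by
    intro n x
    have h := ratio_pow hm hX hM n
    rw [lam_eq hX hM] at h ⊢
    exact integral_gammaKernel_shift hm hl (ratio_ne_zero hX hM n) h x
  have h1 := integral_stepDensity_mul hm (l := rate m Xbar) hM0 (continuous_candidateLow m Xbar M c)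
    (continuous_candidateHigh m Xbar M c) hy
  simp only [candidate] at h1 ⊢
  rw [h1]
  simp only [candidateLow, candidateHigh]
  rw [integral_mul_sum Finset.univ (k := fun u => gammaKernel m (rate m Xbar) (y - u))
      (by fun_prop) _ (fun n _ => continuous_lowPart _ _ _),
    integral_mul_sum Finset.univ (k := fun u => gammaKernel m (rate m Xbar) (y - u))
      (by fun_prop) (w := fun (n : Fin m) v => Complex.exp (-(lam m Xbar M n * ((v + M : ℝ) : ℂ)))) _
      (fun n _ => by fun_prop), ← Finset.sum_add_distrib]
  -- Below M the defect of the low part cancels the shifted high part for each n, whatever the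
  -- coefficients.
  by_cases hyM : y < M
  · rw [if_pos hyM, if_neg hyM.not_ge, add_zero, min_eq_left hyM.le]
    refine Finset.sum_congr rfl fun n _ => ?_
    rw [hlow, hhigh]
    ring
  -- Above M the low part is integrated over [0, M] only. The separated kernel and the Taylor
  -- polynomial combine, power by power, into the B_{sn}.
  · rw [if_neg hyM, if_pos (not_lt.1 hyM), min_eq_right (not_lt.1 hyM)]
    simp only [Finset.mul_sum]
    rw [Finset.sum_comm, ← Finset.sum_add_distrib]
    refine Finset.sum_congr rfl fun n _ => ?_
    rw [integral_gammaKernel_sub_mul hm (continuous_lowPart _ _ _), hhigh, ← mul_add]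
    have h2 : ∀ s ∈ Finset.range m, (tailTerm m Xbar s y : ℂ) * (coeffBsn m Xbar M s n * c n) =
        lam m Xbar M n * c n * ((y : ℂ) ^ s / (s.factorial : ℂ) * Complex.exp (-(rate m Xbar * y)) *
        ((rate m Xbar : ℂ) ^ m * (-1) ^ (m - 1 - s) / ((m - 1 - s).factorial : ℂ) *
        (∫ u in (0 : ℝ)..M, (u : ℂ) ^ (m - 1 - s) * Complex.exp (rate m Xbar * u) *
          lowPart m (rate m Xbar) (ratio m Xbar M n) u) -
        (rate m Xbar * ratio m Xbar M n) ^ s)) := by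
      intro s hs
      rw [coeffBsn_eq hm hX hM (Finset.mem_range.1 hs), tailTerm]
      have := pow_ne_zero (s + 1) hl0
      push_cast
      field_simp
    rw [Finset.sum_congr rfl h2, ← Finset.mul_sum]
    simp only [mul_sub, Finset.sum_sub_distrib]
    have h3 : ∑ q ∈ Finset.range m, (rate m Xbar * ratio m Xbar M n * y) ^ q / (q.factorial : ℂ) *
        Complex.exp (-(rate m Xbar * y)) = ∑ s ∈ Finset.range m, (y : ℂ) ^ s / (s.factorial : ℂ) *
        Complex.exp (-(rate m Xbar * y)) * (rate m Xbar * ratio m Xbar M n) ^ s := by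
      refine Finset.sum_congr rfl fun s _ => ?_
      simp only [mul_pow]
      ring
    rw [← h3, ← Finset.sum_mul]
    ring

lemma integrableOn_candidateHigh : IntegrableOn (candidateHigh m Xbar M c) (Ici M) := by
  rw [integrableOn_Ici_iff_integrableOn_Ioi]
  refine integrable_finsetSum _ fun n _ => Integrable.const_mul ?_ _
  have := integrableOn_exp_mul_complex_Ioi (a := -lam m Xbar M n)
    (by simpa using lam_re_pos hm hX hM n) M
  simp only [neg_mul] at this
  exact this

lemma integrable_candidate : Integrable (candidate m Xbar M c) volIci := by
  have hM0 := hX.trans hM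
  change IntegrableOn (candidate m Xbar M c) (Ici 0)
  rw [← Ico_union_Ici_eq_Ici hM0.le]
  refine IntegrableOn.union ?_ ?_
  · refine ((continuous_candidateLow m Xbar M c).integrableOn_Icc.mono_set
      Ico_subset_Icc_self).congr_fun (fun x hx => ?_) measurableSet_Ico
    rw [candidate_of_lt hx.2]
  · refine (integrableOn_candidateHigh hm hX hM c).congr_fun (fun x hx => ?_) measurableSet_Ici
    rw [candidate_of_le hx]

lemma integral_candidate :
    ∫ x, candidate m Xbar M c x ∂volIci = ∑ n : Fin m, coeffD m Xbar M n * c n := by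
  have hM0 := hX.trans hM
  have hI := integrable_candidate hm hX hM c
  have hI' : IntegrableOn (candidate m Xbar M c) (Ici 0) := hI
  change ∫ x in Ici 0, candidate m Xbar M c x = _
  rw [← Ico_union_Ici_eq_Ici hM0.le] at hI' ⊢
  rw [setIntegral_union (by
      rw [Set.disjoint_left]; exact fun x hx hx' => absurd hx.2 (not_lt.2 hx')) measurableSet_Ici
      (hI'.mono_set subset_union_left) (hI'.mono_set subset_union_right)]
  have h1 : ∫ x in Ico 0 M, candidate m Xbar M c x =
      ∑ n : Fin m, lam m Xbar M n * c n *
        ∫ u in (0 : ℝ)..M, lowPart m (rate m Xbar) (ratio m Xbar M n) u := by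
    rw [setIntegral_congr_fun measurableSet_Ico (g := candidateLow m Xbar M c) fun x hx =>
      candidate_of_lt hx.2]
    rw [integral_Ico_eq_integral_Ioc, ← intervalIntegral.integral_of_le hM0.le]
    have := integral_mul_sum Finset.univ (k := fun _ => 1) continuous_const
      (fun n : Fin m => lam m Xbar M n * c n)
      (fun n _ => continuous_lowPart m (rate m Xbar) (ratio m Xbar M n)) 0 M
    simpa only [one_mul, candidateLow] using this
  have h2 : ∫ x in Ici M, candidate m Xbar M c x =
      ∑ n : Fin m, c n * Complex.exp (-(lam m Xbar M n * M)) := by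
    rw [setIntegral_congr_fun measurableSet_Ici (g := candidateHigh m Xbar M c) fun x hx =>
      candidate_of_le hx]
    rw [integral_Ici_eq_integral_Ioi]
    have hre : ∀ n : ℕ, (-lam m Xbar M n).re < 0 := fun n => by
      simpa using lam_re_pos hm hX hM n
    simp only [candidateHigh]
    rw [integral_finsetSum]
    · refine Finset.sum_congr rfl fun n _ => ?_
      rw [integral_const_mul]
      have h := integral_exp_mul_complex_Ioi (hre n) M
      simp only [neg_mul] at h
      rw [h]
      have := lam_ne_zero hm hX hM n
      field_simp
    · intro n _
      have := integrableOn_exp_mul_complex_Ioi (hre n) M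
      simp only [neg_mul] at this
      exact Integrable.const_mul this _
  rw [h1, h2, ← Finset.sum_add_distrib]
  refine Finset.sum_congr rfl fun n _ => ?_
  rw [coeffD_eq hm hX hM]
  ring

/-- The Markov results concern real functions; a real-linear functional `φ` covers real and
imaginary parts at once. -/
lemma transfer_candidate (φ : ℂ →L[ℝ] ℝ) :
    transfer volIci (stepDensity m (rate m Xbar) M) (fun x => φ (candidate m Xbar M c x)) =ᵐ[volIci]
      fun y => φ (candidate m Xbar M c y) + if M ≤ y then
        ∑ s ∈ Finset.range m, tailTerm m Xbar s y * φ (∑ n : Fin m, coeffBsn m Xbar M s n * c n)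
      else 0 := by
  have hk := isMarkovDensity_stepDensity (a := m) (M := M) (by exact_mod_cast hm) (rate_pos hm hX)
  have hI := integrable_candidate hm hX hM c
  have hne : ∀ᵐ y ∂volIci, y ≠ 0 := ae_restrict_of_ae (by simp [ae_iff])
  have hsmul : ∀ (a : ℝ) (z : ℂ), φ ((a : ℂ) * z) = a * φ z := fun a z => by
    rw [← Complex.real_smul, map_smul, smul_eq_mul]
  filter_upwards [hne, ae_restrict_mem measurableSet_Ici, hk.ae_integrable hI.re,
    hk.ae_integrable hI.im] with y hy0 hy1 hre him
  have hy : 0 < y := lt_of_le_of_ne hy1 (Ne.symm hy0)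
  have hint : Integrable (fun x => (stepDensity m (rate m Xbar) M x y : ℂ) *
      candidate m Xbar M c x) volIci := by
    refine Integrable.re_im_iff.1 ⟨?_, ?_⟩
    · refine hre.congr (ae_of_all _ fun x => ?_)
      simp
    · refine him.congr (ae_of_all _ fun x => ?_)
      simp
  have h1 := φ.integral_comp_comm hint
  rw [integral_stepDensity_candidate hm hX hM c hy] at h1
  simp only [hsmul] at h1
  rw [transfer, h1, map_add]
  congr 1
  split_ifs
  · rw [map_sum]
    exact Finset.sum_congr rfl fun s _ => hsmul _ _
  · exact map_zero φ

omit hM in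
lemma tailTerm_pos (s : ℕ) {x : ℝ} (hx : 0 < x) : 0 < tailTerm m Xbar s x := by
  have := rate_pos hm hX
  unfold tailTerm
  positivity

/-- Conservation of mass: the discrepancy coefficients can only be equal if they vanish. -/
lemma eq_zero_of_coeffBsn_const {κ : ℂ}
    (hκ : ∀ s < m, ∑ n : Fin m, coeffBsn m Xbar M s n * c n = κ) : κ = 0 := by
  have hM0 := hX.trans hM
  have hk := isMarkovDensity_stepDensity (a := m) (M := M) (by exact_mod_cast hm) (rate_pos hm hX)
  have key : ∀ φ : ℂ →L[ℝ] ℝ, φ κ = 0 := by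
    intro φ
    have hI : Integrable (fun x => φ (candidate m Xbar M c x)) volIci :=
      φ.integrable_comp (integrable_candidate hm hX hM c)
    have hT := hk.integrable_transfer hI
    set q : ℝ → ℝ := (Ici M).indicator fun y => ∑ s ∈ Finset.range m, tailTerm m Xbar s y with hq
    have h1 : (fun y => φ κ * q y) =ᵐ[volIci] fun y =>
        transfer volIci (stepDensity m (rate m Xbar) M) (fun x => φ (candidate m Xbar M c x)) y -
          φ (candidate m Xbar M c y) := by
      filter_upwards [transfer_candidate hm hX hM c φ] with y hy
      rw [hy, add_sub_cancel_left]
      simp only [hq, indicator, mem_Ici]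
      split_ifs
      · rw [Finset.mul_sum]
        refine Finset.sum_congr rfl fun s hs => ?_
        rw [hκ s (Finset.mem_range.1 hs), mul_comm]
      · exact mul_zero _
    have h2 : Integrable (fun y => φ κ * q y) volIci := (hT.sub hI).congr h1.symm
    -- A step of the chain preserves integrals, so the discrepancy integrates to zero.
    have h3 : φ κ * ∫ y, q y ∂volIci = 0 := by
      rw [← integral_const_mul, integral_congr_ae h1, integral_sub hT hI, hk.integral_transfer hI,
        sub_self]
    by_contra hne
    -- Integrability of `q` comes for free: `φ κ * q` is a difference of integrable functions.
    have hqi : Integrable q volIci := (integrable_const_mul_iff (IsUnit.mk0 _ hne) q).1 h2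
    have hqpos : ∀ y, M ≤ y → 0 < q y := by
      intro y hy
      rw [hq, indicator_of_mem (show y ∈ Ici M from hy)]
      exact Finset.sum_pos (fun s _ => tailTerm_pos hm hX s (hM0.trans_le hy))
        ⟨0, Finset.mem_range.2 (by omega)⟩
    have hq0 : 0 ≤ q := indicator_nonneg fun y hy =>
      Finset.sum_nonneg fun s _ => (tailTerm_pos hm hX s (hM0.trans_le hy)).le
    have h4 := (integral_eq_zero_iff_of_nonneg hq0 hqi).1 ((mul_eq_zero.1 h3).resolve_left hne)
    have h5 : volIci (Ici M) = 0 := by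
      refine measure_mono_null (fun y hy => ?_) (ae_iff.1 h4)
      exact (hqpos y hy).ne'
    rw [Measure.restrict_apply measurableSet_Ici, inter_eq_left.2 (Ici_subset_Ici.2 hM0.le),
      Real.volume_Ici] at h5
    exact ENNReal.top_ne_zero h5
  exact Complex.ext (key Complex.reCLM) (key Complex.imCLM)

lemma transfer_candidate_of_coeffBsn_eq_zero
    (h0 : ∀ s < m, ∑ n : Fin m, coeffBsn m Xbar M s n * c n = 0) (φ : ℂ →L[ℝ] ℝ) :
    transfer volIci (stepDensity m (rate m Xbar) M) (fun x => φ (candidate m Xbar M c x)) =ᵐ[volIci]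
      fun y => φ (candidate m Xbar M c y) := by
  filter_upwards [transfer_candidate hm hX hM c φ] with y hy
  rw [hy, Finset.sum_eq_zero fun s hs => by
    rw [h0 s (Finset.mem_range.1 hs), map_zero, mul_zero], ite_self, add_zero]

/-! ### Nonsingularity of the linear system -/

/-- The exponentials `exp (-λ_n x)` are linearly independent on `(M, ∞)`. -/
lemma eq_zero_of_candidateHigh_eq_zero (h : ∀ x, M < x → candidateHigh m Xbar M c x = 0) :
    c = 0 := by
  set d : Fin m → ℂ := fun n => lam m Xbar M n * c n with hd
  have hderiv : ∀ j : ℕ, ∀ x : ℝ, M < x → ∑ n : Fin m, d n * (-lam m Xbar M n) ^ j *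
      Complex.exp (-(lam m Xbar M n * x)) = 0 := by
    intro j
    induction j with
    | zero => intro x hx; simpa [hd, candidateHigh] using h x hx
    | succ j ih =>
      intro x hx
      have h1 : HasDerivAt (fun x : ℝ => ∑ n : Fin m, d n * (-lam m Xbar M n) ^ j *
          Complex.exp (-(lam m Xbar M n * x))) (∑ n : Fin m, d n * (-lam m Xbar M n) ^ (j + 1) *
          Complex.exp (-(lam m Xbar M n * x))) x := by
        refine HasDerivAt.fun_sum fun n _ => ?_
        have h2 : HasDerivAt (fun x : ℝ => -(lam m Xbar M n * (x : ℂ))) (-lam m Xbar M n) x := by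
          have h4 : HasDerivAt (fun x : ℝ => -lam m Xbar M n * (x : ℂ)) (-lam m Xbar M n * 1) x :=
            (Complex.ofRealCLM.hasDerivAt (x := x)).const_mul (-lam m Xbar M n)
          simpa only [neg_mul, mul_one] using h4
        refine (h2.cexp.const_mul (d n * (-lam m Xbar M n) ^ j)).congr_deriv ?_
        rw [pow_succ]
        ring
      have h3 : (fun x : ℝ => ∑ n : Fin m, d n * (-lam m Xbar M n) ^ j *
          Complex.exp (-(lam m Xbar M n * x))) =ᶠ[𝓝 x] fun _ => 0 := by
        filter_upwards [lt_mem_nhds hx] with z hz using ih z hz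
      exact h1.unique ((hasDerivAt_const x (0 : ℂ)).congr_of_eventuallyEq h3)
  have hinj : Function.Injective fun n : Fin m => -lam m Xbar M n := fun n n' h =>
    lam_injective hm hX hM (neg_injective h)
  -- All derivatives at the interior point M + 1 vanish: a Vandermonde system with distinct nodes
  -- -λ_n.
  have hv := Matrix.eq_zero_of_forall_pow_sum_mul_pow_eq_zero hinj
    (v := fun n => d n * Complex.exp (-(lam m Xbar M n * ((M + 1 : ℝ) : ℂ)))) fun j => by
      rw [← hderiv j (M + 1) (by linarith)]
      exact Finset.sum_congr rfl fun n _ => by ring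
  funext n
  have h1 := congrFun hv n
  simp only [hd, Pi.zero_apply, mul_eq_zero, Complex.exp_ne_zero, or_false,
    lam_ne_zero hm hX hM n, false_or] at h1
  exact h1

omit hm hX hM in
lemma systemMatrix_mulVec (s : Fin m) : (systemMatrix m Xbar M *ᵥ c) s =
    ∑ n : Fin m, coeffD m Xbar M n * c n + ∑ n : Fin m, coeffBsn m Xbar M s n * c n := by
  simp only [systemMatrix, Matrix.mulVec, dotProduct, Matrix.of_apply, add_mul,
    Finset.sum_add_distrib]

/-- A solution of the linear system with constant right-hand side satisfies the discrepancy
equations, and the constant is its total mass. -/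
lemma coeff_of_systemMatrix_mulVec_eq {κ : ℂ} (h : ∀ s, (systemMatrix m Xbar M *ᵥ c) s = κ) :
    (∀ s < m, ∑ n : Fin m, coeffBsn m Xbar M s n * c n = 0) ∧
      ∑ n : Fin m, coeffD m Xbar M n * c n = κ := by
  have h1 : ∀ s < m, ∑ n : Fin m, coeffBsn m Xbar M s n * c n =
      κ - ∑ n : Fin m, coeffD m Xbar M n * c n := by
    intro s hs
    rw [← h ⟨s, hs⟩, systemMatrix_mulVec]
    ring
  have h2 := eq_zero_of_coeffBsn_const hm hX hM c h1
  exact ⟨fun s hs => (h1 s hs).trans h2, (sub_eq_zero.1 h2).symm⟩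

/-- The projected candidate is invariant with integral zero, so irreducibility annihilates it. -/
lemma candidate_ae_eq_zero (h0 : ∀ s < m, ∑ n : Fin m, coeffBsn m Xbar M s n * c n = 0)
    (φ : ℂ →L[ℝ] ℝ) (hφ : φ (∑ n : Fin m, coeffD m Xbar M n * c n) = 0) :
    (fun x => φ (candidate m Xbar M c x)) =ᵐ[volIci] 0 := by
  have hm0 : (0 : ℝ) < m := by exact_mod_cast hm
  have hk := isMarkovDensity_stepDensity (a := m) (M := M) hm0 (rate_pos hm hX)
  have hI := integrable_candidate hm hX hM c
  refine hk.eq_zero_of_invariant (fun h hh hn hi hI => pos_of_stepDensity_invariant hm0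
    (rate_pos hm hX) (hX.trans hM) hh hn hi hI) (φ.integrable_comp hI)
    (transfer_candidate_of_coeffBsn_eq_zero hm hX hM c h0 φ) ?_
  rw [φ.integral_comp_comm hI, integral_candidate hm hX hM c, hφ]

/-- A kernel vector yields an invariant candidate of total mass zero. It vanishes almost everywhere,
hence by continuity everywhere above M, and the exponentials are independent. -/
lemma isUnit_systemMatrix : IsUnit (systemMatrix m Xbar M) := by
  rw [← Matrix.mulVec_injective_iff_isUnit]
  refine (injective_iff_map_eq_zero (systemMatrix m Xbar M).mulVecLin).2 fun c hc => ?_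
  obtain ⟨h0, hD⟩ := coeff_of_systemMatrix_mulVec_eq hm hX hM c (κ := 0) fun s => congrFun hc s
  refine eq_zero_of_candidateHigh_eq_zero hm hX hM c ?_
  have h1 : candidateHigh m Xbar M c =ᵐ[volume.restrict (Ioi M)] fun _ => (0 : ℂ) := by
    have hsub : Ioi M ⊆ Ici 0 := fun x hx => (hX.trans hM).le.trans (le_of_lt hx)
    filter_upwards [ae_restrict_of_ae_restrict_of_subset hsub
      (candidate_ae_eq_zero hm hX hM c h0 Complex.reCLM (by rw [hD, map_zero])),
      ae_restrict_of_ae_restrict_of_subset hsub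
      (candidate_ae_eq_zero hm hX hM c h0 Complex.imCLM (by rw [hD, map_zero])),
      ae_restrict_mem measurableSet_Ioi] with x hre him hx
    rw [candidate_of_le (le_of_lt (mem_Ioi.1 hx))] at hre him
    exact Complex.ext hre him
  exact fun x hx => Measure.eqOn_open_of_ae_eq h1 isOpen_Ioi
    (continuous_candidateHigh m Xbar M c).continuousOn continuousOn_const hx

omit hm in
/-- An equation between continuous functions of the candidate which holds almost everywhere on
`[0, ∞)` holds everywhere there. -/
lemma candidate_eq_of_ae {Φ Ψ : ℂ → ℂ} (hΦ : Continuous Φ) (hΨ : Continuous Ψ)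
    (h : ∀ᵐ x ∂volIci, Φ (candidate m Xbar M c x) = Ψ (candidate m Xbar M c x)) {x : ℝ}
    (hx : 0 ≤ x) : Φ (candidate m Xbar M c x) = Ψ (candidate m Xbar M c x) := by
  by_cases hxM : x < M
  · have h1 : (fun x => Φ (candidateLow m Xbar M c x)) =ᵐ[volume.restrict (Ico 0 M)]
        fun x => Ψ (candidateLow m Xbar M c x) := by
      filter_upwards [ae_restrict_of_ae_restrict_of_subset Ico_subset_Ici_self h,
        ae_restrict_mem measurableSet_Ico] with z hz hz'
      rwa [candidate_of_lt hz'.2] at hz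
    have h2 := Measure.eqOn_Ico_of_ae_eq _ h1
      (hΦ.comp (continuous_candidateLow m Xbar M c)).continuousOn
      (hΨ.comp (continuous_candidateLow m Xbar M c)).continuousOn ⟨hx, hxM⟩
    rw [candidate_of_lt hxM]
    exact h2
  · have h1 : (fun x => Φ (candidateHigh m Xbar M c x)) =ᵐ[volume.restrict (Ici M)]
        fun x => Ψ (candidateHigh m Xbar M c x) := by
      filter_upwards [ae_restrict_of_ae_restrict_of_subset (Ici_subset_Ici.2 (hX.trans hM).le) h,
        ae_restrict_mem measurableSet_Ici] with z hz hz'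
      rwa [candidate_of_le (mem_Ici.1 hz')] at hz
    have h2 := Measure.eqOn_of_ae_eq h1
      (hΦ.comp (continuous_candidateHigh m Xbar M c)).continuousOn
      (hΨ.comp (continuous_candidateHigh m Xbar M c)).continuousOn
      (by rw [interior_Ici, closure_Ioi]) (not_lt.1 hxM)
    rw [candidate_of_le (not_lt.1 hxM)]
    exact h2

end

end OnOffBuffer

end

/-! ### The limiting density -/

theorem mainTheorem4 (m : ℕ) (hm : 1 ≤ m) (Xbar M : ℝ) (hX : 0 < Xbar) (hM : Xbar < M) :
    ∃ c : Fin m → ℂ,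
      OnOffBuffer.systemMatrix m Xbar M *ᵥ c = 1 ∧
      (∀ c' : Fin m → ℂ, OnOffBuffer.systemMatrix m Xbar M *ᵥ c' = 1 → c' = c) ∧
      ∃ g : ℝ → ℝ,
        OnOffBuffer.IsLimitingPdf.{u} (gammaMeasure m (OnOffBuffer.rate m Xbar)) M g ∧
        (∀ x : ℝ, 0 ≤ x → x < M →
          (g x : ℂ) = ∑ n : Fin m,
            OnOffBuffer.lam m Xbar M n * c n * OnOffBuffer.lowBracket m Xbar M n x) ∧
        (∀ x : ℝ, M ≤ x →
          (g x : ℂ) = ∑ n : Fin m,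
            OnOffBuffer.lam m Xbar M n * c n *
              Complex.exp (-(OnOffBuffer.lam m Xbar M n * x))) := by
  have hunit := OnOffBuffer.isUnit_systemMatrix hm hX hM
  have hM0 := hX.trans hM
  have hm0 : (0 : ℝ) < m := by exact_mod_cast hm
  have hr := OnOffBuffer.rate_pos hm hX
  obtain ⟨c, hc⟩ := Matrix.mulVec_surjective_iff_isUnit.2 hunit 1
  refine ⟨c, hc, fun c' hc' =>
    Matrix.mulVec_injective_iff_isUnit.2 hunit (hc'.trans hc.symm), ?_⟩
  obtain ⟨h0, hD⟩ := OnOffBuffer.coeff_of_systemMatrix_mulVec_eq hm hX hM c (κ := 1)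
    fun s => congrFun hc s
  have hI := OnOffBuffer.integrable_candidate hm hX hM c
  have hk := OnOffBuffer.isMarkovDensity_stepDensity (a := m) (M := M) hm0 hr
  have hinv := OnOffBuffer.transfer_candidate_of_coeffBsn_eq_zero hm hX hM c h0 Complex.reCLM
  have hmass : ∫ x, Complex.reCLM (OnOffBuffer.candidate m Xbar M c x) ∂OnOffBuffer.volIci = 1 := by
    rw [Complex.reCLM.integral_comp_comm hI, OnOffBuffer.integral_candidate hm hX hM c, hD]
    simp
  -- The real part is invariant with mass 1, hence positive almost everywhere; continuity of each
  -- piece upgrades this to nonnegativity at every point.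
  have hpos := hk.pos_of_invariant (fun h hh hn hi hI =>
    OnOffBuffer.pos_of_stepDensity_invariant hm0 hr hM0 hh hn hi hI)
    (Complex.reCLM.integrable_comp hI) hinv (by rw [hmass]; exact one_pos)
  have hnn : ∀ x, 0 ≤ x → 0 ≤ (OnOffBuffer.candidate m Xbar M c x).re := by
    intro x hx
    have h := OnOffBuffer.candidate_eq_of_ae hX hM c (Φ := fun z => ((|z.re| : ℝ) : ℂ))
      (Ψ := fun z => (z.re : ℂ)) (by fun_prop) (by fun_prop) (by
        filter_upwards [hpos] with z hz
        exact congrArg _ (abs_of_pos hz)) hx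
    rw [← Complex.ofReal_inj.1 h]
    exact abs_nonneg _
  -- The mass 1 is real, so the imaginary part is invariant with integral zero and vanishes.
  have hreal : ∀ x, 0 ≤ x → ((OnOffBuffer.candidate m Xbar M c x).re : ℂ) =
      OnOffBuffer.candidate m Xbar M c x := by
    intro x hx
    refine OnOffBuffer.candidate_eq_of_ae hX hM c (Φ := fun z => (z.re : ℂ)) (Ψ := fun z => z)
      (by fun_prop) (by fun_prop) ?_ hx
    filter_upwards [OnOffBuffer.candidate_ae_eq_zero hm hX hM c h0 Complex.imCLM
      (by rw [hD]; simp)] with z hz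
    have hz' : (OnOffBuffer.candidate m Xbar M c z).im = 0 := hz
    exact Complex.ext (by simp) (by simp [hz'])
  refine ⟨fun x => (OnOffBuffer.candidate m Xbar M c x).re, ?_, fun x hx hxM => ?_, fun x hx => ?_⟩
  · exact OnOffBuffer.isLimitingPdf_of_invariant (by exact_mod_cast hm) hr hM0
      (Complex.measurable_re.comp (OnOffBuffer.measurable_candidate m Xbar M c)) hnn
      (Complex.reCLM.integrable_comp hI) hmass hinv
  · rw [hreal x hx, OnOffBuffer.candidate_of_lt hxM, OnOffBuffer.candidateLow]
    exact Finset.sum_congr rfl fun n _ => by rw [OnOffBuffer.lowBracket_eq hm hX hM]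
  · rw [hreal x (hM0.le.trans hx), OnOffBuffer.candidate_of_le hx,
      OnOffBuffer.candidateHigh]
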